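/- Let $\mathbb T^2=(\mathbb R/2\pi\mathbb Z)^2$ with Lebesgue measure, and write $L^2$ for the complex-valued square-integrable functions on $\mathbb T^2$ and $L^2_0$ for those with zero mean. Let $\Lambda=(-\Delta)^{1/2}$ (Fourier multiplier $|k|$), let $\Lambda^{-1}$ be its inverse on mean-free functions (Fourier multiplier $|k|^{-1}$, $k\neq 0$), and let $R_j=\partial_j\Lambda^{-1}$ ($j=1,2$) be the Riesz transforms (Fourier multipliers $ik_j/|k|$, $k\ne0$). Let $\theta_0\in C^\infty(\mathbb T^2)$ be a real mean-free steady state of the critical dissipative quasi-geostrophic equation with smooth force $f$, i.e. $$q_0\cdot\nabla\theta_0+\Lambda\theta_0=f,\qquad q_0=(R_2\theta_0,-R_1\theta_0)\in C^\infty(\mathbb T^2).$$ Let $L$ be the linearized operator $$Lv=-q_0\cdot\nabla v-(R_2v,-R_1v)\cdot\nabla\theta_0-\Lambda v,\qquad \mathcal D(L)=\Big\{v\in H^1(\mathbb T^2):\int_{\mathbb T^2}v\,dx=0\Big\}\subset L^2 .$$ Suppose that $L$ has an eigenvalue $\mu$ with $\lambda:=\operatorname{Re}\mu>0$ such that $\operatorname{Re}\nu\le\lambda$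 for every eigenvalue $\nu$ of $L$. Let $\delta>0$ and $L_\delta=L-(\lambda+\delta)I$. Then $L_\delta$ is the infinitesimal generator of a $C_0$-semigroup $(e^{L_\delta t})_{t\ge0}$ on $L^2_0$, and for every $\gamma\in[0,1]$ there is a constant $C>0$, depending only on $\gamma,\delta,\theta_0$, such that $$\|e^{L_\delta t}v\|_{L^2}\le \frac{C}{t^{\gamma}}\,\|v\|_{L^2}^{1-\gamma}\,\|\Lambda^{-1}v\|_{L^2}^{\gamma}$$ for all $t>0$ and all smooth mean-free functions $v$ on $\mathbb T^2$ (with the convention $0^0=1$). -/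

import Mathlib

open MeasureTheory Filter Topology
open scoped ENNReal ContDiff ComplexConjugate

noncomputable section

namespace QG

instance factTwoPiPos : Fact (0 < 2 * Real.pi) := ⟨Real.two_pi_pos⟩

/-- The two-dimensional torus `(ℝ / 2πℤ)²`; its `volume` is Lebesgue measure, of total
mass `(2π)²`. -/
abbrev Torus : Type := Fin 2 → AddCircle (2 * Real.pi)

/-- The complex Hilbert space `L²(𝕋²)`. -/
abbrev L2 : Type := Lp ℂ 2 (volume : Measure Torus)

/-- The frequency lattice `ℤ²`. -/
abbrev Freq : Type := Fin 2 → ℤ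

/-! ### Fourier series on the torus -/

/-- The exponential `x ↦ exp (i k·x)`. -/
def expMode (k : Freq) : C(Torus, ℂ) where
  toFun x := ∏ j, fourier (k j) (x j)
  continuous_toFun := by fun_prop

lemma expMode_neg (k : Freq) (x : Torus) : expMode (-k) x = conj (expMode k x) := by
  simp only [expMode, Pi.neg_apply, fourier_neg, ContinuousMap.coe_mk, map_prod]

lemma expMode_add (k l : Freq) (x : Torus) :
    expMode (k + l) x = expMode k x * expMode l x := by
  simp only [expMode, Pi.add_apply, fourier_add, ContinuousMap.coe_mk, ← Finset.prod_mul_distrib]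

/-- The star subalgebra of `C(𝕋², ℂ)` generated by the exponentials. -/
def expAlgebra : StarSubalgebra ℂ C(Torus, ℂ) where
  toSubalgebra := Algebra.adjoin ℂ (Set.range expMode)
  star_mem' := by
    change Algebra.adjoin ℂ (Set.range expMode) ≤ star (Algebra.adjoin ℂ (Set.range expMode))
    refine Algebra.adjoin_le ?_
    rintro _ ⟨n, rfl⟩
    refine Algebra.subset_adjoin ⟨-n, ?_⟩
    ext1 x
    simp only [expMode_neg, starRingEnd_apply, ContinuousMap.star_apply]

lemma expAlgebra_coe :
    expAlgebra.toSubalgebra.toSubmodule = Submodule.span ℂ (Set.range expMode) := by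
  apply Algebra.adjoin_eq_span_of_subset
  refine .trans (fun x ↦ Submonoid.closure_induction (fun _ ↦ id) ⟨0, ?_⟩ ?_)
    Submodule.subset_span
  · ext z
    simp only [expMode, Pi.zero_apply, fourier_zero, Finset.prod_const, one_pow,
      ContinuousMap.coe_mk, ContinuousMap.one_apply]
  · rintro _ _ _ _ ⟨m, rfl⟩ ⟨n, rfl⟩
    exact ⟨m + n, by ext z; simp [expMode_add]⟩

lemma expMode_single (x : Torus) (i : Fin 2) :
    expMode (Pi.single i 1) x = fourier 1 (x i) := by
  fin_cases i <;> simp [expMode, Fin.prod_univ_two]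

lemma expAlgebra_separatesPoints : expAlgebra.SeparatesPoints := by
  intro x y hxy
  rw [Ne, funext_iff, not_forall] at hxy
  obtain ⟨i, hi⟩ := hxy
  refine ⟨_, ⟨expMode (Pi.single i 1), Algebra.subset_adjoin ⟨Pi.single i 1, rfl⟩, rfl⟩, ?_⟩
  dsimp only
  rw [expMode_single, expMode_single, fourier_one, fourier_one]
  intro h
  exact hi (AddCircle.injective_toCircle Real.two_pi_pos.ne' (Circle.coe_injective h))

lemma span_expMode_closure_eq_top :
    (Submodule.span ℂ (Set.range expMode)).topologicalClosure = ⊤ := by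
  rw [← expAlgebra_coe]
  exact congr_arg (Subalgebra.toSubmodule <| StarSubalgebra.toSubalgebra ·)
    (ContinuousMap.starSubalgebra_topologicalClosure_eq_top_of_separatesPoints _
      expAlgebra_separatesPoints)

/-- The `L²`-normalised exponential `(2π)⁻¹ exp (i k·x)`. -/
def expL2 (k : Freq) : L2 :=
  ((2 * Real.pi : ℝ) : ℂ)⁻¹ • ContinuousMap.toLp (E := ℂ) 2 volume ℂ (expMode k)

lemma orthonormal_expL2 : Orthonormal ℂ expL2 := by
  have hpi : ((2 * Real.pi : ℝ) : ℂ) ≠ 0 := by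
    exact_mod_cast Real.two_pi_pos.ne'
  have h1 : ∀ n : ℤ, ∫ t : AddCircle (2 * Real.pi), fourier n t =
      if n = 0 then ((2 * Real.pi : ℝ) : ℂ) else 0 := by
    intro n
    split_ifs with h
    · subst h
      simp [Measure.real, AddCircle.measure_univ, Real.pi_pos.le]
    · exact integral_eq_zero_of_add_right_eq_neg (μ := volume)
        (fourier_add_half_inv_index h Real.two_pi_pos)
  have h2 : ∀ k : Freq, ∫ x : Torus, expMode k x =
      if k = 0 then ((2 * Real.pi : ℝ) : ℂ) ^ 2 else 0 := by
    intro k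
    have : ∫ x : Torus, expMode k x = ∏ j, ∫ t : AddCircle (2 * Real.pi), fourier (k j) t := by
      simp only [expMode, ContinuousMap.coe_mk]
      exact integral_fintype_prod_volume_eq_prod (fun j t => (fourier (k j) t : ℂ))
    rw [this]
    split_ifs with h
    · subst h; simp only [h1]; simp
    · obtain ⟨i, hi⟩ := Function.ne_iff.mp h
      exact Finset.prod_eq_zero (Finset.mem_univ i) (by rw [h1, if_neg (by simpa using hi)])
  rw [orthonormal_iff_ite]
  intro k l
  rw [expL2, expL2, inner_smul_left, inner_smul_right, ContinuousMap.inner_toLp]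
  have h3 : ∀ x, expMode l x * (starRingEnd ℂ) (expMode k x) = expMode (l + -k) x := by
    intro x; rw [expMode_add, expMode_neg]
  simp only [h3, h2]
  have h4 : l + -k = 0 ↔ k = l := by rw [← sub_eq_add_neg, sub_eq_zero, eq_comm]
  simp only [h4]
  split_ifs
  · rw [map_inv₀, Complex.conj_ofReal]; field_simp
  · simp

lemma span_expL2_closure_eq_top :
    (Submodule.span ℂ (Set.range expL2)).topologicalClosure = ⊤ := by
  have h : Submodule.span ℂ (Set.range expL2) = Submodule.span ℂ
      (Set.range fun k => ContinuousMap.toLp (E := ℂ) 2 (volume : Measure Torus) ℂ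
        (expMode k)) := by
    have hpi : ((2 * Real.pi : ℝ) : ℂ) ≠ 0 := by
      exact_mod_cast Real.two_pi_pos.ne'
    apply le_antisymm <;> rw [Submodule.span_le] <;> rintro _ ⟨k, rfl⟩
    · exact Submodule.smul_mem _ _ (Submodule.subset_span ⟨k, rfl⟩)
    · have : (fun k => ContinuousMap.toLp (E := ℂ) 2 (volume : Measure Torus) ℂ (expMode k)) k =
          ((2 * Real.pi : ℝ) : ℂ) • expL2 k := by
        simp only [expL2]; rw [smul_smul, mul_inv_cancel₀ hpi, one_smul]
      rw [this]
      exact Submodule.smul_mem _ _ (Submodule.subset_span ⟨k, rfl⟩)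
  rw [h]
  have := (ContinuousMap.toLp_denseRange ℂ (volume : Measure Torus) ℂ
    (p := 2) (by simp)).topologicalClosure_map_submodule span_expMode_closure_eq_top
  rw [Submodule.map_span, ← Set.range_comp] at this
  exact this

/-- The Fourier basis of `L²(𝕋²)`. The coefficient of `v` is
`fourierBasis.repr v k = (2π)⁻¹ ∫ exp (-i k·x) v(x) dx`. -/
def fourierBasis : HilbertBasis Freq ℂ L2 :=
  HilbertBasis.mk orthonormal_expL2 span_expL2_closure_eq_top.ge

/-- The maximal domain of the Fourier multiplier with symbol `m`: those `v ∈ L²(𝕋²)` for which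
`k ↦ m k * v̂ k` is square summable. -/
def multiplierDomain (m : Freq → ℂ) : Submodule ℂ L2 where
  carrier := {v | Memℓp (fun k => m k * fourierBasis.repr v k) 2}
  zero_mem' := by
    change Memℓp (fun k => m k * fourierBasis.repr (0 : L2) k) 2
    simp [zero_mem_ℓp']
  add_mem' := by
    intro v w hv hw
    change Memℓp (fun k => m k * fourierBasis.repr (v + w) k) 2
    have h : (fun k => m k * fourierBasis.repr (v + w) k) =
        (fun k => m k * fourierBasis.repr v k) + fun k => m k * fourierBasis.repr w k := by
      funext k
      rw [map_add, lp.coeFn_add, Pi.add_apply, Pi.add_apply, mul_add]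
    rw [h]
    exact Memℓp.add hv hw
  smul_mem' := by
    intro c v hv
    change Memℓp (fun k => m k * fourierBasis.repr (c • v) k) 2
    have h : (fun k => m k * fourierBasis.repr (c • v) k) =
        c • fun k => m k * fourierBasis.repr v k := by
      funext k
      rw [map_smul, lp.coeFn_smul, Pi.smul_apply, Pi.smul_apply, smul_eq_mul, smul_eq_mul,
        mul_left_comm]
    rw [h]
    exact Memℓp.const_smul hv c

/-- The square summable sequence `k ↦ m k * v̂ k`. -/
def multiplierSeq (m : Freq → ℂ) (v : multiplierDomain m) : lp (fun _ : Freq => ℂ) 2 :=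
  ⟨fun k => m k * fourierBasis.repr (v : L2) k, v.2⟩

/-- The Fourier multiplier with symbol `m` as an unbounded operator on `L²(𝕋²)`, with its
maximal domain: the `k`-th Fourier coefficient of the image of `v` is `m k * v̂ k`. -/
def fourierMultiplier (m : Freq → ℂ) : L2 →ₗ.[ℂ] L2 where
  domain := multiplierDomain m
  toFun :=
    { toFun := fun v => fourierBasis.repr.symm (multiplierSeq m v)
      map_add' := by
        intro v w
        have h : multiplierSeq m (v + w) = multiplierSeq m v + multiplierSeq m w := by
          apply lp.ext
          funext k
          rw [lp.coeFn_add, Pi.add_apply]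
          change m k * fourierBasis.repr ((v : L2) + w) k = m k * fourierBasis.repr (v : L2) k +
            m k * fourierBasis.repr (w : L2) k
          rw [map_add, lp.coeFn_add, Pi.add_apply, mul_add]
        rw [h, map_add]
      map_smul' := by
        intro c v
        have h : multiplierSeq m (c • v) = c • multiplierSeq m v := by
          apply lp.ext
          funext k
          rw [lp.coeFn_smul, Pi.smul_apply]
          change m k * fourierBasis.repr (c • (v : L2)) k =
            c • (m k * fourierBasis.repr (v : L2) k)
          rw [map_smul, lp.coeFn_smul, Pi.smul_apply, smul_eq_mul, smul_eq_mul, mul_left_comm]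
        rw [h, map_smul, RingHom.id_apply] }

lemma mem_fourierMultiplier_domain {m : Freq → ℂ} {v : L2} :
    v ∈ (fourierMultiplier m).domain ↔ Memℓp (fun k => m k * fourierBasis.repr v k) 2 :=
  Iff.rfl

lemma fourierMultiplier_domain_le {m n : Freq → ℂ} (h : ∀ k, ‖n k‖ ≤ ‖m k‖) :
    (fourierMultiplier m).domain ≤ (fourierMultiplier n).domain := by
  intro v hv
  rw [mem_fourierMultiplier_domain] at hv ⊢
  refine hv.mono' fun k => ?_
  rw [norm_mul, norm_mul]
  exact mul_le_mul_of_nonneg_right (h k) (norm_nonneg _)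

/-- A Fourier multiplier whose symbol is bounded by `1`, as an operator on all of `L²(𝕋²)`. -/
def contractionMultiplier (m : Freq → ℂ) (hm : ∀ k, ‖m k‖ ≤ 1) : L2 →ₗ[ℂ] L2 :=
  (fourierMultiplier m).toFun.comp (LinearMap.id.codRestrict _ fun v => by
    have hv : v ∈ (fourierMultiplier fun _ => 1).domain := by
      rw [mem_fourierMultiplier_domain]
      simpa using lp.memℓp (fourierBasis.repr v)
    exact fourierMultiplier_domain_le (by simpa using hm) hv)

/-- The Euclidean length of a frequency. -/
def freqNorm (k : Freq) : ℝ := Real.sqrt ((k 0 : ℝ) ^ 2 + (k 1 : ℝ) ^ 2)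

lemma abs_le_freqNorm (k : Freq) (j : Fin 2) : |(k j : ℝ)| ≤ freqNorm k := by
  rw [freqNorm]
  apply Real.abs_le_sqrt
  fin_cases j
  · simpa using sq_nonneg (k 1 : ℝ)
  · simpa using sq_nonneg (k 0 : ℝ)

lemma freqNorm_inv_le (k : Freq) : (freqNorm k)⁻¹ ≤ 1 := by
  by_cases hk : k = 0
  · simp [hk, freqNorm]
  · obtain ⟨j, hj⟩ := Function.ne_iff.mp hk
    have h1 : (1 : ℝ) ≤ |(k j : ℝ)| := by exact_mod_cast Int.one_le_abs hj
    exact inv_le_one_of_one_le₀ (h1.trans (abs_le_freqNorm k j))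

/-- `Λ = (-Δ)^{1/2}`, the Fourier multiplier `|k|`; its domain is `H¹(𝕋²)`. -/
def Lam : L2 →ₗ.[ℂ] L2 := fourierMultiplier fun k => (freqNorm k : ℂ)

/-- The (weak) partial derivative `∂_j`, the Fourier multiplier `i k_j`. -/
def partialD (j : Fin 2) : L2 →ₗ.[ℂ] L2 := fourierMultiplier fun k => Complex.I * (k j : ℂ)

lemma Lam_domain_le (j : Fin 2) : Lam.domain ≤ (partialD j).domain := by
  refine fourierMultiplier_domain_le fun k => ?_
  rw [norm_mul, Complex.norm_I, one_mul, Complex.norm_intCast, Complex.norm_real]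
  exact (abs_le_freqNorm k j).trans (le_abs_self _)

/-- `Λ⁻¹`, the Fourier multiplier `|k|⁻¹`. It is used on mean-free functions, for which the
value `0` of the symbol at `k = 0` plays no role. -/
def LamInv : L2 →ₗ[ℂ] L2 :=
  contractionMultiplier (fun k => ((freqNorm k)⁻¹ : ℝ)) fun k => by
    rw [Complex.norm_real, Real.norm_of_nonneg
      (inv_nonneg.2 (show 0 ≤ freqNorm k from Real.sqrt_nonneg _))]
    exact freqNorm_inv_le k

/-- The Riesz transform `R_j = ∂_j Λ⁻¹`, the Fourier multiplier `i k_j / |k|` (`0` at `k = 0`).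
With this sign, `R_j (Λ ψ) = ∂_j ψ`. -/
def riesz (j : Fin 2) : L2 →ₗ[ℂ] L2 :=
  contractionMultiplier (fun k => Complex.I * (k j : ℂ) / (freqNorm k : ℂ)) fun k => by
    rw [norm_div, norm_mul, Complex.norm_I, one_mul, Complex.norm_intCast, Complex.norm_real]
    exact div_le_one_of_le₀ ((abs_le_freqNorm k j).trans (le_abs_self _)) (norm_nonneg _)

/-! ### Smooth functions and multiplication operators -/

/-- The covering map `ℝ² → 𝕋²`. -/
def proj (x : Fin 2 → ℝ) : Torus := fun j => (x j : AddCircle (2 * Real.pi))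

/-- `f ∈ C^∞(𝕋²)`: the periodic function `f ∘ proj` on `ℝ²` is smooth. -/
def IsSmooth {E : Type*} [NormedAddCommGroup E] [NormedSpace ℝ E] (f : Torus → E) : Prop :=
  ContDiff ℝ ∞ (fun x => f (proj x))

lemma isQuotientMap_proj : IsQuotientMap proj := by
  have : IsOpenQuotientMap proj :=
    IsOpenQuotientMap.piMap (f := fun (_ : Fin 2) (t : ℝ) => (t : AddCircle (2 * Real.pi)))
      fun _ => QuotientAddGroup.isOpenQuotientMap_mk
  exact this.isQuotientMap

lemma IsSmooth.continuous {E : Type*} [NormedAddCommGroup E] [NormedSpace ℝ E] {f : Torus → E}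
    (hf : IsSmooth f) : Continuous f :=
  isQuotientMap_proj.continuous_iff.2 (ContDiff.continuous hf)

/-- The classical partial derivative `∂_j f` on the torus. -/
def pderiv (j : Fin 2) (f : Torus → ℝ) (x : Torus) : ℝ :=
  deriv (fun s : ℝ => f (x + Pi.single j (s : AddCircle (2 * Real.pi)))) 0

lemma IsSmooth.continuous_pderiv {f : Torus → ℝ} (hf : IsSmooth f) (j : Fin 2) :
    Continuous (pderiv j f) := by
  refine isQuotientMap_proj.continuous_iff.2 ?_
  have h : pderiv j f ∘ proj =
      fun x => fderiv ℝ (fun y => f (proj y)) x (Pi.single j 1) := by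
    funext x
    have hd : DifferentiableAt ℝ (fun y => f (proj y)) x :=
      (ContDiff.differentiable hf (by simp)).differentiableAt
    rw [← hd.lineDeriv_eq_fderiv, lineDeriv, Function.comp_apply, pderiv]
    congr 1
    funext s
    congr 1
    funext i
    by_cases hi : i = j
    · subst hi; simp [proj]
    · simp [proj, hi]
  rw [h]
  exact ((ContDiff.continuous_fderiv hf (by simp)).clm_apply continuous_const)

/-- The class in `L²(𝕋²)` of a continuous real function. -/
def toL2 (f : Torus → ℝ) (hf : Continuous f) : L2 :=
  ContinuousMap.toLp (E := ℂ) 2 volume ℂ ⟨fun x => (f x : ℂ), Complex.continuous_ofReal.comp hf⟩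

/-- Multiplication of `L²` functions by a continuous real function. -/
def mulOp (a : Torus → ℝ) (ha : Continuous a) : L2 →ₗ[ℂ] L2 where
  toFun v := MemLp.toLp (fun x => (a x : ℂ) * v x) (by
    obtain ⟨C, hC⟩ := isCompact_univ.exists_bound_of_continuousOn
      (f := a) ha.continuousOn
    refine (Lp.memLp v).of_le_mul (c := C)
      ((Complex.continuous_ofReal.comp ha).aestronglyMeasurable.mul (Lp.aestronglyMeasurable v))
      (Eventually.of_forall fun x => ?_)
    rw [norm_mul, Complex.norm_real]
    exact mul_le_mul_of_nonneg_right (hC x (Set.mem_univ x)) (norm_nonneg _))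
  map_add' v w := by
    rw [← MemLp.toLp_add, MemLp.toLp_eq_toLp_iff]
    filter_upwards [Lp.coeFn_add v w] with x hx
    rw [hx, Pi.add_apply, Pi.add_apply, mul_add]
  map_smul' c v := by
    rw [RingHom.id_apply, ← MemLp.toLp_const_smul, MemLp.toLp_eq_toLp_iff]
    filter_upwards [Lp.coeFn_smul c v] with x hx
    rw [hx, Pi.smul_apply, Pi.smul_apply, smul_eq_mul, smul_eq_mul, mul_left_comm]

/-- The space of mean-free `L²` functions. -/
def L2mf : Submodule ℂ L2 where
  carrier := {v | ∫ x, v x = 0}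
  zero_mem' := by
    rw [Set.mem_ofPred_eq, integral_congr_ae (Lp.coeFn_zero ℂ 2 (volume : Measure Torus))]
    simp
  add_mem' := by
    intro v w hv hw
    rw [Set.mem_ofPred_eq] at *
    rw [integral_congr_ae (Lp.coeFn_add v w)]
    simp only [Pi.add_apply]
    rw [integral_add ((Lp.memLp v).integrable (by norm_num))
      ((Lp.memLp w).integrable (by norm_num)), hv, hw, add_zero]
  smul_mem' := by
    intro c v hv
    rw [Set.mem_ofPred_eq] at *
    rw [integral_congr_ae (Lp.coeFn_smul c v)]
    simp only [Pi.smul_apply]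
    rw [integral_smul, hv, smul_zero]

/-- `v ∈ L²(𝕋²)` has a `C^∞` representative. -/
def HasSmoothRep (v : L2) : Prop := ∃ g : Torus → ℂ, IsSmooth g ∧ v =ᵐ[volume] g

/-! ### Steady flows and the linearized operator -/

/-- A smooth, mean-free, real steady state `θ` of the forced critical quasi-geostrophic equation
`q·∇θ + Λθ = f` together with its velocity `q = (R₂ θ, -R₁ θ)`, also smooth. The equation holds
with the smooth force `f := q·∇θ + Λθ`, so it puts no further condition on `θ`. The indices
`0, 1 : Fin 2` stand for the coordinates `x₁, x₂`. -/
structure SteadyFlow where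
  θ : Torus → ℝ
  q : Fin 2 → Torus → ℝ
  smooth_θ : IsSmooth θ
  smooth_q : ∀ j, IsSmooth (q j)
  mean_θ : ∫ x, θ x = 0
  q_zero : toL2 (q 0) (smooth_q 0).continuous = riesz 1 (toL2 θ smooth_θ.continuous)
  q_one : toL2 (q 1) (smooth_q 1).continuous = -riesz 0 (toL2 θ smooth_θ.continuous)

/-- `{v ∈ H¹(𝕋²) : ∫ v = 0}`. -/
def H1mf : Submodule ℂ L2 := Lam.domain ⊓ L2mf

lemma H1mf_le_Lam : H1mf ≤ Lam.domain := inf_le_left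

lemma H1mf_le_partialD (j : Fin 2) : H1mf ≤ (partialD j).domain :=
  H1mf_le_Lam.trans (Lam_domain_le j)

/-- The linear map underlying the linearized operator; `Lfun_apply` is its formula. -/
def SteadyFlow.Lfun (F : SteadyFlow) : H1mf →ₗ[ℂ] L2 :=
  -(∑ j, mulOp (F.q j) (F.smooth_q j).continuous ∘ₗ (partialD j).toFun ∘ₗ
      Submodule.inclusion (H1mf_le_partialD j))
  - (mulOp (pderiv 0 F.θ) (F.smooth_θ.continuous_pderiv 0) ∘ₗ riesz 1
      - mulOp (pderiv 1 F.θ) (F.smooth_θ.continuous_pderiv 1) ∘ₗ riesz 0) ∘ₗ H1mf.subtype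
  - Lam.toFun ∘ₗ Submodule.inclusion H1mf_le_Lam

lemma SteadyFlow.Lfun_apply (F : SteadyFlow) (v : H1mf) :
    F.Lfun v =
      -(∑ j, mulOp (F.q j) (F.smooth_q j).continuous (partialD j ⟨v, H1mf_le_partialD j v.2⟩))
      - (mulOp (pderiv 0 F.θ) (F.smooth_θ.continuous_pderiv 0) (riesz 1 v)
          - mulOp (pderiv 1 F.θ) (F.smooth_θ.continuous_pderiv 1) (riesz 0 v))
      - Lam ⟨v, H1mf_le_Lam v.2⟩ := by
  simp only [SteadyFlow.Lfun, LinearMap.sub_apply, LinearMap.neg_apply, LinearMap.sum_apply]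
  rfl

/-- The linearized operator `L v = -q·∇v - (R₂ v, -R₁ v)·∇θ - Λ v` in `L²(𝕋²)`, with domain
`{v ∈ H¹(𝕋²) : ∫ v = 0}`. -/
def SteadyFlow.L (F : SteadyFlow) : L2 →ₗ.[ℂ] L2 where
  domain := H1mf
  toFun := F.Lfun

/-- `A - c I`, with the domain of `A`. -/
def shift {E : Type*} [AddCommGroup E] [Module ℂ E] (A : E →ₗ.[ℂ] E) (c : ℂ) : E →ₗ.[ℂ] E where
  domain := A.domain
  toFun := A.toFun - c • A.domain.subtype

/-- `μ` is an eigenvalue of the unbounded operator `A`. -/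
def IsEigenvalue {E : Type*} [AddCommGroup E] [Module ℂ E] (A : E →ₗ.[ℂ] E) (μ : ℂ) : Prop :=
  ∃ φ : A.domain, (φ : E) ≠ 0 ∧ A φ = μ • (φ : E)

/-! ### Strongly continuous semigroups -/

/-- A `C₀`-semigroup `(T t)_{t ≥ 0}` of bounded operators on `X` (values at `t < 0` are
irrelevant). -/
structure C0Semigroup (X : Type*) [NormedAddCommGroup X] [NormedSpace ℂ X] where
  T : ℝ → X →L[ℂ] X
  map_zero : T 0 = ContinuousLinearMap.id ℂ X
  map_add : ∀ s t, 0 ≤ s → 0 ≤ t → T (s + t) = (T s).comp (T t)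
  tendsto_zero : ∀ x, Tendsto (fun t => T t x) (𝓝[>] 0) (𝓝 x)

/-- The operator `A`, with domain and range in the subspace `X` of `E`, is the infinitesimal
generator of the semigroup `S` on `X`: for `v ∈ X`, the limit of `t⁻¹ (S(t) v - v)` as `t ↓ 0`
exists in `X` iff `v ∈ D(A)`, and it is then `A v`. -/
def C0Semigroup.IsGeneratedBy {E : Type*} [NormedAddCommGroup E] [NormedSpace ℂ E]
    {X : Submodule ℂ E} (S : C0Semigroup X) (A : E →ₗ.[ℂ] E) : Prop :=
  A.domain ≤ X ∧ (∀ v : A.domain, A v ∈ X) ∧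
    ∀ v w : X, Tendsto (fun t : ℝ => (t⁻¹ : ℂ) • (S.T t v - v)) (𝓝[>] 0) (𝓝 w) ↔
      ∃ h : (v : E) ∈ A.domain, A ⟨v, h⟩ = w

end QG

end

noncomputable section

namespace QG

/-! ### Scalar differential inequalities -/

/-! In the Fourier basis `L - c` is the diagonal matrix `-|k| - c` plus the transport matrix of
`-q·∇`, of first order but skew-Hermitian because `q` is divergence free, plus a matrix of order
zero. Both perturbations are dominated by a convolution kernel in `k - l` that decays rapidly, since
`θ` and `q` are smooth. Commuting the weight `|k|^n` past the skew part costs one order, so Schur's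
test gives, for every finite truncation and every `-2 ≤ n ≤ 2`, the energy inequality of
`DissipativeSystem` with one constant `K` (`matrix_energy_le`). Everything else about the semigroup
follows abstractly from this inequality.

Construction: the Galerkin flows satisfy exponential bounds uniform in the truncation and form
Cauchy sequences (`norm_flow_sub_flow_le`, `cauchySeq_flow`); their limit is the semigroup `T`. Its
generator is `G x ↦ M x`, where `G = Λ⁻¹` and `M = (L - c)Λ⁻¹` (`tendsto_iff_exists_G`).

Smoothing: in time `t` the flow gains two powers of the weight in the squared norm at cost `t⁻²`
(`sq_mul_en_flow_le`). From `n = 0` to `2` this puts `T t v` in the domain, so `T 1` is compact;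
from `n = -2` to `0` it gives `‖T t v‖ ≤ e^{Kt} t⁻¹ ‖Λ⁻¹ v‖`.

Decay: by compactness, nonzero spectrum of `T 1` consists of eigenvalues, and each is `exp ν` with
`ν` an eigenvalue of the generator (`exists_eigenvalue_of_T_one`). With `c = λ + δ` all such `ν`
have real part at most `-δ`, and Gelfand's formula gives decay at rate `δ/2` (`exists_norm_T_le`).
Combined with smoothing over a unit time, this turns the local bound into a `C/t` bound for all `t`;
interpolation with the uniform `L²` bound gives every `γ` in `[0, 1]` (`exists_norm_T_le_rpow`). -/

lemma le_exp_mul_of_hasDerivAt_le {f f' : ℝ → ℝ} {a c : ℝ} (ha : 0 ≤ a) (hc : 0 ≤ c)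
    (hf : ∀ t, HasDerivAt f (f' t) t) {τ : ℝ} (h : ∀ t, 0 ≤ t → t ≤ τ → f' t ≤ a * f t + c)
    (hτ : 0 ≤ τ) : f τ ≤ Real.exp (a * τ) * (f 0 + c * τ) := by
  -- The function `e^{-at} f - ct` is nonincreasing on `[0, τ]`: its derivative is at most `c
  -- (e^{-at} - 1) ≤ 0`.
  have hg : ∀ t, HasDerivAt (fun t => Real.exp (-(a * t)) * f t - c * t)
      (Real.exp (-(a * t)) * (f' t - a * f t) - c) t := by
    intro t
    have h1 : HasDerivAt (fun t : ℝ => Real.exp (-(a * t))) (Real.exp (-(a * t)) * -a) t := by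
      have := ((hasDerivAt_id t).const_mul a).neg.exp
      simpa using this
    have h2 := (h1.mul (hf t)).sub ((hasDerivAt_id t).const_mul c)
    refine h2.congr_deriv ?_
    ring
  have hanti : AntitoneOn (fun t => Real.exp (-(a * t)) * f t - c * t) (Set.Icc 0 τ) := by
    refine antitoneOn_of_deriv_nonpos (convex_Icc 0 τ)
      (fun t _ => (hg t).continuousAt.continuousWithinAt)
      (fun t _ => (hg t).differentiableAt.differentiableWithinAt) fun t ht => ?_
    rw [interior_Icc] at ht
    rw [(hg t).deriv]
    have h1 := h t ht.1.le ht.2.le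
    have h2 : Real.exp (-(a * t)) ≤ 1 := Real.exp_le_one_iff.2 (by nlinarith [ht.1])
    nlinarith [Real.exp_pos (-(a * t)),
      mul_le_mul_of_nonneg_left (sub_le_iff_le_add'.2 h1) (Real.exp_pos (-(a * t))).le]
  have h3 := hanti (Set.left_mem_Icc.2 hτ) (Set.right_mem_Icc.2 hτ) hτ
  simp only [mul_zero, neg_zero, Real.exp_zero, one_mul, sub_zero] at h3
  have h4 : f τ = Real.exp (a * τ) * (Real.exp (-(a * τ)) * f τ) := by
    rw [← mul_assoc, ← Real.exp_add, add_neg_cancel, Real.exp_zero, one_mul]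
  rw [h4]
  exact mul_le_mul_of_nonneg_left (by linarith) (Real.exp_pos _).le

/-! ### Dissipative systems and their Galerkin truncations -/

/-- An unbounded operator `A` on a Hilbert space `E`, given in a Hilbert basis `b` with weights
`w`, which is a first order perturbation of `-Λ`, where `Λ b k = w k • b k`. Here `G = Λ⁻¹` and
`M = A Λ⁻¹`, so that `A` has domain `range G` and `A (G x) = M x`. The field `energy` is the energy
estimate in the norm `∑ w ^ n |u k| ^ 2`, for all finite truncations of `A`. -/
structure DissipativeSystem (ι E : Type*) [NormedAddCommGroup E] [InnerProductSpace ℂ E] where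
  b : HilbertBasis ι ℂ E
  w : ι → ℝ
  G : E →L[ℂ] E
  M : E →L[ℂ] E
  K : ℝ
  one_le_w : ∀ k, 1 ≤ w k
  finite_w : ∀ N : ℝ, {k | w k ≤ N}.Finite
  inner_G : ∀ k x, inner ℂ (b k) (G x) = ((w k)⁻¹ : ℂ) * inner ℂ (b k) x
  K_nonneg : 0 ≤ K
  energy : ∀ n : ℤ, -2 ≤ n → n ≤ 2 → ∀ (F : Finset ι) (u : E),
    ∑ k ∈ F, w k ^ n * (conj (inner ℂ (b k) u) *
        inner ℂ (b k) (M (∑ l ∈ F, ((w l : ℂ) * inner ℂ (b l) u) • b l))).re ≤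
      -∑ k ∈ F, w k ^ (n + 1) * ‖inner ℂ (b k) u‖ ^ 2 +
        K * ∑ k ∈ F, w k ^ n * ‖inner ℂ (b k) u‖ ^ 2

namespace DissipativeSystem

variable {ι E : Type*} [NormedAddCommGroup E] [InnerProductSpace ℂ E] (D : DissipativeSystem ι E)

lemma w_pos (k : ι) : 0 < D.w k := zero_lt_one.trans_le (D.one_le_w k)

/-- The finite rank diagonal operator with entries `c k`, `k ∈ F`. -/
def diag (F : Finset ι) (c : ι → ℂ) : E →L[ℂ] E :=
  ∑ k ∈ F, c k • (innerSL ℂ (D.b k)).smulRight (D.b k)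

lemma diag_apply (F : Finset ι) (c : ι → ℂ) (x : E) :
    D.diag F c x = ∑ k ∈ F, (c k * inner ℂ (D.b k) x) • D.b k := by
  simp [diag, smul_smul]

open Classical in
lemma inner_diag (F : Finset ι) (c : ι → ℂ) (x : E) (k : ι) :
    inner ℂ (D.b k) (D.diag F c x) = if k ∈ F then c k * inner ℂ (D.b k) x else 0 := by
  simp only [diag_apply, inner_sum, inner_smul_right,
    (orthonormal_iff_ite.1 D.b.orthonormal), mul_ite, mul_one, mul_zero, Finset.sum_ite_eq]

lemma inner_diag_of_mem {F : Finset ι} (c : ι → ℂ) (x : E) {k : ι} (hk : k ∈ F) :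
    inner ℂ (D.b k) (D.diag F c x) = c k * inner ℂ (D.b k) x := by
  rw [inner_diag, if_pos hk]

lemma inner_diag_of_notMem {F : Finset ι} (c : ι → ℂ) (x : E) {k : ι} (hk : k ∉ F) :
    inner ℂ (D.b k) (D.diag F c x) = 0 := by
  rw [inner_diag, if_neg hk]

lemma ext_inner {x y : E} (h : ∀ k, inner ℂ (D.b k) x = inner ℂ (D.b k) y) : x = y := by
  apply D.b.repr.injective
  ext k
  rw [D.b.repr_apply_apply, D.b.repr_apply_apply, h]

/-- The projection onto the span of `b k`, `k ∈ F`. -/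
def P (F : Finset ι) : E →L[ℂ] E := D.diag F fun _ => 1

/-- The truncation of `Λ` to the span of `b k`, `k ∈ F`. -/
def W (F : Finset ι) : E →L[ℂ] E := D.diag F fun k => D.w k

/-- The Galerkin truncation of the operator. -/
def trunc (F : Finset ι) : E →L[ℂ] E := D.P F ∘L D.M ∘L D.W F

/-- The square of the weighted norm of the `F`-part of `u`. -/
def en (n : ℤ) (F : Finset ι) (u : E) : ℝ := ∑ k ∈ F, D.w k ^ n * ‖inner ℂ (D.b k) u‖ ^ 2

lemma en_nonneg (n : ℤ) (F : Finset ι) (u : E) : 0 ≤ D.en n F u :=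
  Finset.sum_nonneg fun k _ => mul_nonneg (zpow_nonneg (D.w_pos k).le _) (sq_nonneg _)

lemma sum_sq_le (F : Finset ι) (u : E) : ∑ k ∈ F, ‖inner ℂ (D.b k) u‖ ^ 2 ≤ ‖u‖ ^ 2 :=
  D.b.orthonormal.sum_inner_products_le u

lemma en_zero_le (F : Finset ι) (u : E) : D.en 0 F u ≤ ‖u‖ ^ 2 := by
  simpa [en] using D.sum_sq_le F u

lemma inner_trunc_of_mem {F : Finset ι} (u : E) {k : ι} (hk : k ∈ F) :
    inner ℂ (D.b k) (D.trunc F u) = inner ℂ (D.b k) (D.M (D.W F u)) := by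
  rw [trunc, ContinuousLinearMap.comp_apply, P, inner_diag_of_mem _ _ _ hk, one_mul]
  rfl

lemma inner_trunc_of_notMem {F : Finset ι} (u : E) {k : ι} (hk : k ∉ F) :
    inner ℂ (D.b k) (D.trunc F u) = 0 := by
  rw [trunc, ContinuousLinearMap.comp_apply, P, inner_diag_of_notMem _ _ _ hk]

/-- Half the derivative of the energy `en n F` along the truncated flow. -/
def rate (n : ℤ) (F : Finset ι) (u : E) : ℝ :=
  ∑ k ∈ F, D.w k ^ n * (conj (inner ℂ (D.b k) u) * inner ℂ (D.b k) (D.trunc F u)).re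

lemma rate_le {n : ℤ} (h1 : -2 ≤ n) (h2 : n ≤ 2) (F : Finset ι) (u : E) :
    D.rate n F u ≤ -D.en (n + 1) F u + D.K * D.en n F u := by
  refine le_trans (le_of_eq (Finset.sum_congr rfl fun k hk => ?_)) (D.energy n h1 h2 F u)
  rw [D.inner_trunc_of_mem u hk, W, diag_apply]

lemma hasSum_inner (x y : E) :
    HasSum (fun k => conj (inner ℂ (D.b k) x) * inner ℂ (D.b k) y) (inner ℂ x y) := by
  simpa using D.b.hasSum_inner_mul_inner x y

lemma re_inner_trunc (F : Finset ι) (u v : E) :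
    (inner ℂ u (D.trunc F v)).re =
      ∑ k ∈ F, (conj (inner ℂ (D.b k) u) * inner ℂ (D.b k) (D.trunc F v)).re := by
  have h := (D.hasSum_inner u (D.trunc F v)).unique
    (hasSum_sum_of_ne_finset_zero (s := F) fun k hk => by
      rw [D.inner_trunc_of_notMem v hk, mul_zero])
  rw [h, Complex.re_sum]

/-- The unweighted energy estimate: each truncation minus `K` is dissipative in the full norm, with
`K` independent of `F`. -/
lemma re_inner_trunc_self_le (F : Finset ι) (u : E) :
    (inner ℂ u (D.trunc F u)).re ≤ D.K * ‖u‖ ^ 2 := by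
  have h := D.rate_le (n := 0) (by norm_num) (by norm_num) F u
  simp only [rate, zpow_zero, one_mul] at h
  rw [re_inner_trunc]
  refine h.trans ?_
  nlinarith [D.en_nonneg (0 + 1) F u, mul_le_mul_of_nonneg_left (D.en_zero_le F u) D.K_nonneg]

lemma hasDerivAt_norm_sq {f : ℝ → E} {f' : E} {t : ℝ} (h : HasDerivAt f f' t) :
    HasDerivAt (fun t => ‖f t‖ ^ 2) (2 * (inner ℂ (f t) f').re) t := by
  have h1 := h.inner ℂ h
  have h2 := Complex.reCLM.hasFDerivAt.comp_hasDerivAt t h1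
  have h3 : ⇑Complex.reCLM ∘ (fun t => inner ℂ (f t) (f t)) = fun t => ‖f t‖ ^ 2 := by
    funext s
    simp only [Function.comp_apply, Complex.reCLM_apply]
    exact (norm_sq_eq_re_inner (𝕜 := ℂ) (f s)).symm
  rw [h3] at h2
  refine h2.congr_deriv ?_
  rw [Complex.reCLM_apply, Complex.add_re, ← inner_conj_symm f' (f t), Complex.conj_re]
  ring

/-! ### Galerkin flows and their weighted energy estimates. -/

variable [CompleteSpace E]

/-- The semigroup generated by the Galerkin truncation. -/
def flow (F : Finset ι) (t : ℝ) : E →L[ℂ] E := NormedSpace.exp (t • D.trunc F)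

lemma flow_zero (F : Finset ι) : D.flow F 0 = 1 := by
  rw [flow, zero_smul, NormedSpace.exp_zero]

lemma flow_add (F : Finset ι) (s t : ℝ) : D.flow F (s + t) = D.flow F s * D.flow F t := by
  let _ : NormedAlgebra ℚ (E →L[ℂ] E) := NormedAlgebra.restrictScalars ℚ ℝ _
  rw [flow, add_smul, NormedSpace.exp_add_of_commute, flow, flow]
  exact ((Commute.refl (D.trunc F)).smul_left s).smul_right t

lemma hasDerivAt_flow (F : Finset ι) (v : E) (t : ℝ) :
    HasDerivAt (fun t => D.flow F t v) (D.trunc F (D.flow F t v)) t := by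
  have h := hasDerivAt_exp_smul_const' (𝕂 := ℝ) (D.trunc F) t
  exact ((ContinuousLinearMap.apply ℂ E v).restrictScalars ℝ).hasFDerivAt.comp_hasDerivAt t h

/-- With the generator on the right, the derivative is controlled by `D.trunc F v` at the fixed
vector `v`, through the uniform bound on the flow. -/
lemma hasDerivAt_flow' (F : Finset ι) (v : E) (t : ℝ) :
    HasDerivAt (fun t => D.flow F t v) (D.flow F t (D.trunc F v)) t := by
  have h := hasDerivAt_exp_smul_const (𝕂 := ℝ) (D.trunc F) t
  exact ((ContinuousLinearMap.apply ℂ E v).restrictScalars ℝ).hasFDerivAt.comp_hasDerivAt t h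

lemma hasDerivAt_inner_flow (F : Finset ι) (v : E) (k : ι) (t : ℝ) :
    HasDerivAt (fun t => inner ℂ (D.b k) (D.flow F t v))
      (inner ℂ (D.b k) (D.trunc F (D.flow F t v))) t :=
  ((innerSL ℂ (D.b k)).restrictScalars ℝ).hasFDerivAt.comp_hasDerivAt t (D.hasDerivAt_flow F v t)

lemma norm_flow_apply_le (F : Finset ι) {t : ℝ} (ht : 0 ≤ t) (v : E) :
    ‖D.flow F t v‖ ≤ Real.exp (D.K * t) * ‖v‖ := by
  have h := le_exp_mul_of_hasDerivAt_le (mul_nonneg zero_le_two D.K_nonneg) le_rfl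
    (fun t => hasDerivAt_norm_sq (D.hasDerivAt_flow F v t)) (τ := t)
    (fun s _ _ => by linarith [D.re_inner_trunc_self_le F (D.flow F s v)]) ht
  rw [flow_zero, zero_mul, add_zero, one_apply_eq_self] at h
  refine le_of_sq_le_sq ?_ (by positivity)
  rw [mul_pow, ← Real.exp_nat_mul]
  refine h.trans_eq ?_
  congr 2
  push_cast
  ring

lemma hasDerivAt_en_flow (n : ℤ) (F : Finset ι) (v : E) (t : ℝ) :
    HasDerivAt (fun t => D.en n F (D.flow F t v))
      (2 * D.rate n F (D.flow F t v)) t := by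
  simp only [en, rate, Finset.mul_sum]
  refine HasDerivAt.fun_sum fun k _ => ?_
  have h := (D.hasDerivAt_inner_flow F v k t).norm_sq.const_mul (D.w k ^ n)
  refine h.congr_deriv ?_
  rw [Complex.inner, mul_left_comm, mul_comm (conj _)]

lemma en_flow_le {n : ℤ} (h1 : -2 ≤ n) (h2 : n ≤ 2) (F : Finset ι) {t : ℝ} (ht : 0 ≤ t) (v : E) :
    D.en n F (D.flow F t v) ≤ Real.exp (2 * D.K * t) * D.en n F v := by
  have h := le_exp_mul_of_hasDerivAt_le (mul_nonneg zero_le_two D.K_nonneg) le_rfl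
    (fun t => D.hasDerivAt_en_flow n F v t) (τ := t)
    (fun s _ _ => by
      linarith [D.rate_le h1 h2 F (D.flow F s v), D.en_nonneg (n + 1) F (D.flow F s v)]) ht
  simpa [flow_zero] using h

/-- Smoothing by two powers of the weight. -/
lemma sq_mul_en_flow_le {n : ℤ} (h1 : -2 ≤ n) (h2 : n ≤ 0) (F : Finset ι) {t : ℝ} (ht : 0 ≤ t)
    (v : E) :
    t ^ 2 * D.en (n + 2) F (D.flow F t v) ≤ Real.exp (2 * D.K * t) * D.en n F v := by
  -- Gronwall for `en n + t * en (n + 1) + t ^ 2 * en (n + 2)`. Differentiating the powers of `t`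
  -- produces `en (n + 1)` and `2 * t * en (n + 2)`; the dissipation of the preceding term absorbs
  -- each.
  have h := le_exp_mul_of_hasDerivAt_le (mul_nonneg zero_le_two D.K_nonneg) le_rfl
    (fun t => ((D.hasDerivAt_en_flow n F v t).add
      ((hasDerivAt_id t).mul (D.hasDerivAt_en_flow (n + 1) F v t))).add
      (((hasDerivAt_id t).pow 2).mul (D.hasDerivAt_en_flow (n + 2) F v t))) (τ := t)
    (fun s hs _ => by
      have e0 := D.rate_le h1 (by omega) F (D.flow F s v)
      have e1 := mul_le_mul_of_nonneg_left
        (D.rate_le (n := n + 1) (by omega) (by omega) F (D.flow F s v)) hs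
      have e2 := mul_le_mul_of_nonneg_left
        (D.rate_le (n := n + 2) (by omega) (by omega) F (D.flow F s v)) (sq_nonneg s)
      rw [add_assoc n 1 1, one_add_one_eq_two] at e1
      have p1 := D.en_nonneg (n + 1) F (D.flow F s v)
      have p3 := mul_nonneg (sq_nonneg s) (D.en_nonneg (n + 2 + 1) F (D.flow F s v))
      simp only [Pi.add_apply, Pi.mul_apply, Pi.pow_apply, id]
      norm_num
      linarith) ht
  simp only [Pi.add_apply, Pi.mul_apply, Pi.pow_apply, id, flow_zero, zero_mul, add_zero, ne_eq,
    OfNat.ofNat_ne_zero, not_false_eq_true, zero_pow, one_apply_eq_self] at h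
  have p0 := D.en_nonneg n F (D.flow F t v)
  have p1 := mul_nonneg ht (D.en_nonneg (n + 1) F (D.flow F t v))
  linarith

end DissipativeSystem

namespace DissipativeSystem

variable {ι E : Type*} [NormedAddCommGroup E] [InnerProductSpace ℂ E] (D : DissipativeSystem ι E)

/-! ### The filtration by weights -/

/-- The finite set of indices of weight at most `N`. -/
def lev (N : ℕ) : Finset ι := (D.finite_w N).toFinset

lemma mem_lev {N : ℕ} {k : ι} : k ∈ D.lev N ↔ D.w k ≤ N := by simp [lev]

lemma lev_mono : Monotone D.lev := fun N K h k hk => by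
  rw [mem_lev] at *
  exact hk.trans (by exact_mod_cast h)

lemma tendsto_lev : Tendsto D.lev atTop atTop :=
  tendsto_atTop_finset_of_monotone D.lev_mono fun k => by
    obtain ⟨N, hN⟩ := exists_nat_ge (D.w k)
    exact ⟨N, D.mem_lev.2 hN⟩

lemma tendsto_P (x : E) : Tendsto (fun N => D.P (D.lev N) x) atTop (𝓝 x) := by
  have h := (D.b.hasSum_repr x).comp D.tendsto_lev
  refine h.congr fun N => ?_
  simp only [Function.comp_apply, P, diag_apply, one_mul, D.b.repr_apply_apply]

lemma hasSum_norm_sq (x : E) : HasSum (fun k => ‖inner ℂ (D.b k) x‖ ^ 2) (‖x‖ ^ 2) := by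
  have h := Complex.hasSum_re (D.hasSum_inner x x)
  have h2 : ‖x‖ ^ 2 = (inner ℂ x x).re := norm_sq_eq_re_inner (𝕜 := ℂ) x
  rw [h2]
  refine h.congr_fun fun k => ?_
  rw [← Complex.normSq_eq_conj_mul_self, Complex.ofReal_re, Complex.normSq_eq_norm_sq]

lemma norm_sq_le_of_sum_le {x : E} {R : ℝ}
    (h : ∀ S : Finset ι, ∑ k ∈ S, ‖inner ℂ (D.b k) x‖ ^ 2 ≤ R) : ‖x‖ ^ 2 ≤ R :=
  hasSum_le_of_sum_le (D.hasSum_norm_sq x) h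

lemma norm_sq_diag (F : Finset ι) (c : ι → ℂ) (x : E) :
    ‖D.diag F c x‖ ^ 2 = ∑ k ∈ F, ‖c k‖ ^ 2 * ‖inner ℂ (D.b k) x‖ ^ 2 := by
  have h := hasSum_sum_of_ne_finset_zero (s := F) (L := .unconditional ι)
    (f := fun k => ‖inner ℂ (D.b k) (D.diag F c x)‖ ^ 2) fun k hk => by
      rw [D.inner_diag_of_notMem c x hk]; simp
  rw [(D.hasSum_norm_sq _).unique h]
  refine Finset.sum_congr rfl fun k hk => ?_
  rw [D.inner_diag_of_mem c x hk, norm_mul, mul_pow]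

lemma norm_P_le (F : Finset ι) (x : E) : ‖D.P F x‖ ≤ ‖x‖ := by
  refine le_of_sq_le_sq ?_ (norm_nonneg _)
  rw [P, norm_sq_diag]
  simpa using D.sum_sq_le F x

lemma norm_sq_W (F : Finset ι) (x : E) : ‖D.W F x‖ ^ 2 = D.en 2 F x := by
  rw [W, norm_sq_diag, en]
  refine Finset.sum_congr rfl fun k _ => ?_
  rw [Complex.norm_real, Real.norm_eq_abs, sq_abs]
  norm_cast

/-- On the range of `G` the growing weights cancel, so `trunc F (G x) = P M P x` is bounded
uniformly in `F`. -/
lemma W_G (F : Finset ι) (x : E) : D.W F (D.G x) = D.P F x := by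
  have h (k : ι) : (D.w k : ℂ) ≠ 0 := by exact_mod_cast (D.w_pos k).ne'
  rw [W, P, diag_apply, diag_apply]
  refine Finset.sum_congr rfl fun k _ => ?_
  rw [D.inner_G, ← mul_assoc, mul_inv_cancel₀ (h k)]

lemma G_W (F : Finset ι) (x : E) : D.G (D.W F x) = D.P F x := by
  classical
  have h (k : ι) : (D.w k : ℂ) ≠ 0 := by exact_mod_cast (D.w_pos k).ne'
  refine D.ext_inner fun k => ?_
  rw [D.inner_G, W, P, inner_diag, inner_diag]
  split_ifs
  · rw [one_mul, ← mul_assoc, inv_mul_cancel₀ (h k), one_mul]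
  · rw [mul_zero]

lemma G_injective : Function.Injective D.G := by
  intro x y hxy
  refine tendsto_nhds_unique (D.tendsto_P x) ((D.tendsto_P y).congr fun N => ?_)
  rw [← W_G, ← W_G, hxy]

lemma en_two_G_le (F : Finset ι) (x : E) : D.en 2 F (D.G x) ≤ ‖x‖ ^ 2 := by
  rw [← norm_sq_W, W_G]
  exact pow_le_pow_left₀ (norm_nonneg _) (D.norm_P_le F x) 2

lemma en_neg_two_le (F : Finset ι) (x : E) : D.en (-2) F x ≤ ‖D.G x‖ ^ 2 := by
  refine le_trans (le_of_eq (Finset.sum_congr rfl fun k _ => ?_)) (D.sum_sq_le F (D.G x))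
  rw [D.inner_G, norm_mul, mul_pow, norm_inv, Complex.norm_real, Real.norm_eq_abs, inv_pow,
    sq_abs, zpow_neg]
  norm_cast

/-- Domain membership is read off from uniform bounds on finite sums: `x` has coefficients `w k * ⟨b
k, v⟩`, which are square summable. -/
lemma exists_G_eq {v : E} {R : ℝ} (hR : 0 ≤ R) (h : ∀ S : Finset ι, D.en 2 S v ≤ R ^ 2) :
    ∃ x, v = D.G x ∧ ‖x‖ ≤ R := by
  have hs : ∀ S : Finset ι,
      ∑ k ∈ S, ‖(D.w k : ℂ) * inner ℂ (D.b k) v‖ ^ (2 : ℝ≥0∞).toReal ≤ R ^ 2 := by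
    intro S
    refine le_trans (le_of_eq (Finset.sum_congr rfl fun k _ => ?_)) (h S)
    rw [norm_mul, Complex.norm_real, Real.norm_of_nonneg (D.w_pos k).le]
    simp [mul_pow]
  let f : lp (fun _ : ι => ℂ) 2 := ⟨fun k => (D.w k : ℂ) * inner ℂ (D.b k) v, memℓp_gen' hs⟩
  refine ⟨D.b.repr.symm f, D.ext_inner fun k => ?_, ?_⟩
  · have hk : (D.w k : ℂ) ≠ 0 := by exact_mod_cast (D.w_pos k).ne'
    rw [D.inner_G, ← D.b.repr_apply_apply (D.b.repr.symm f), LinearIsometryEquiv.apply_symm_apply]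
    change _ = (D.w k : ℂ)⁻¹ * ((D.w k : ℂ) * inner ℂ (D.b k) v)
    rw [← mul_assoc, inv_mul_cancel₀ hk, one_mul]
  · rw [LinearIsometryEquiv.norm_map]
    refine lp.norm_le_of_forall_sum_le (by simp) hR fun S => ?_
    exact (hs S).trans_eq (by simp)

/-! ### Consistency of the truncations on the domain, and the elliptic estimate. -/

lemma norm_trunc_G_le (F : Finset ι) (x : E) : ‖D.trunc F (D.G x)‖ ≤ ‖D.M‖ * ‖x‖ := by
  rw [trunc, ContinuousLinearMap.comp_apply, ContinuousLinearMap.comp_apply, W_G]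
  exact (D.norm_P_le F _).trans ((D.M.le_opNorm _).trans
    (mul_le_mul_of_nonneg_left (D.norm_P_le F x) (norm_nonneg _)))

lemma tendsto_trunc_G (x : E) :
    Tendsto (fun N => D.trunc (D.lev N) (D.G x)) atTop (𝓝 (D.M x)) := by
  have h1 : Tendsto (fun N => D.P (D.lev N) (D.M (D.P (D.lev N) x - x))) atTop (𝓝 0) := by
    have h2 : Tendsto (fun N => D.M (D.P (D.lev N) x - x)) atTop (𝓝 0) := by
      have := (D.M.continuous.tendsto _).comp ((D.tendsto_P x).sub_const x)
      rwa [sub_self, map_zero] at this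
    exact squeeze_zero_norm (fun _ => D.norm_P_le _ _) (tendsto_zero_iff_norm_tendsto_zero.1 h2)
  have h3 := h1.add (D.tendsto_P (D.M x))
  rw [zero_add] at h3
  refine h3.congr fun N => ?_
  rw [trunc, ContinuousLinearMap.comp_apply, ContinuousLinearMap.comp_apply, W_G, ← map_add,
    ← map_add, sub_add_cancel]

/-- The elliptic estimate. -/
lemma norm_le_of_elliptic (x : E) : ‖x‖ ≤ ‖D.M x‖ + D.K * ‖D.G x‖ := by
  have h1 : ∀ N, ‖D.P (D.lev N) x‖ ^ 2 ≤
      ‖x‖ * ‖D.trunc (D.lev N) (D.G x)‖ + D.K * (‖x‖ * ‖D.G x‖) := by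
    intro N
    set F := D.lev N
    -- The weight `w` cancels the `w⁻¹` of one factor `G x`, so the `n = 1` rate at `G x` is `Re ⟨x,
    -- trunc F (G x)⟩`, while its dissipation is `‖P F x‖²`. Cauchy-Schwarz, the limit in `N` and
    -- division by `‖x‖` finish.
    have h := D.rate_le (n := 1) (by norm_num) (by norm_num) F (D.G x)
    have hw : ∀ k, D.w k * (D.w k)⁻¹ = 1 := fun k => mul_inv_cancel₀ (D.w_pos k).ne'
    have e1 : D.rate 1 F (D.G x) = (inner ℂ x (D.trunc F (D.G x))).re := by
      rw [re_inner_trunc, rate]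
      refine Finset.sum_congr rfl fun k _ => ?_
      rw [D.inner_G, zpow_one, map_mul, ← Complex.ofReal_inv, Complex.conj_ofReal, mul_assoc,
        Complex.re_ofReal_mul, ← mul_assoc, hw, one_mul]
    have e2 : D.en (1 + 1) F (D.G x) = ‖D.P F x‖ ^ 2 := by
      rw [← W_G, norm_sq_W]
      rfl
    have e3 : D.en 1 F (D.G x) ≤ ‖x‖ * ‖D.G x‖ := by
      have e4 : D.en 1 F (D.G x) = ∑ k ∈ F, ‖inner ℂ (D.b k) x‖ * ‖inner ℂ (D.b k) (D.G x)‖ := by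
        refine Finset.sum_congr rfl fun k _ => ?_
        rw [D.inner_G, norm_mul, norm_inv, Complex.norm_real,
          Real.norm_of_nonneg (D.w_pos k).le, zpow_one]
        field_simp [(D.w_pos k).ne']
      rw [e4]
      refine (Real.sum_mul_le_sqrt_mul_sqrt _ _ _).trans ?_
      exact mul_le_mul (Real.sqrt_le_left (norm_nonneg _) |>.2 (D.sum_sq_le F x))
        (Real.sqrt_le_left (norm_nonneg _) |>.2 (D.sum_sq_le F _)) (Real.sqrt_nonneg _)
        (norm_nonneg _)
    have e5 : -(inner ℂ x (D.trunc F (D.G x))).re ≤ ‖x‖ * ‖D.trunc F (D.G x)‖ :=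
      (neg_le_abs _).trans ((Complex.abs_re_le_norm _).trans (norm_inner_le_norm _ _))
    rw [e1, e2] at h
    nlinarith [mul_le_mul_of_nonneg_left e3 D.K_nonneg]
  have h2 : ‖x‖ ^ 2 ≤ ‖x‖ * ‖D.M x‖ + D.K * (‖x‖ * ‖D.G x‖) :=
    le_of_tendsto_of_tendsto' ((D.tendsto_P x).norm.pow 2)
      (((D.tendsto_trunc_G x).norm.const_mul _).add_const _) h1
  rcases (norm_nonneg x).eq_or_lt with h0 | h0
  · rw [← h0]
    exact add_nonneg (norm_nonneg _) (mul_nonneg D.K_nonneg (norm_nonneg _))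
  · refine le_of_mul_le_mul_left ?_ h0
    linarith [sq ‖x‖]

/-- Since `u` lives on `F`, the two truncations of `u` differ by the part of `M (W F u)` on `F' \
F`. There `u` vanishes and the weights are at least `N`, so the `en 2` bound on `v` gains a factor
`1/N`. -/
lemma re_inner_trunc_sub_le {F F' : Finset ι} (hF : F ⊆ F') {N : ℝ} (hN : 0 < N)
    (hw : ∀ k ∉ F, N ≤ D.w k) (u v : E) (hu : ∀ k ∉ F, inner ℂ (D.b k) u = 0) :
    (inner ℂ (v - u) (D.trunc F' u - D.trunc F u)).re ≤
      (2 * N)⁻¹ * (D.en 2 F' v + ‖D.M‖ ^ 2 * D.en 2 F u) := by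
  classical
  have hW : D.W F' u = D.W F u := by
    refine D.ext_inner fun k => ?_
    rw [W, W, inner_diag, inner_diag]
    by_cases hk : k ∈ F
    · rw [if_pos hk, if_pos (hF hk)]
    · rw [if_neg hk, hu k hk, mul_zero, ite_self]
  have hc : ∀ k, inner ℂ (D.b k) (D.trunc F' u - D.trunc F u) =
      if k ∈ F' \ F then inner ℂ (D.b k) (D.M (D.W F u)) else 0 := by
    intro k
    rw [inner_sub_right]
    by_cases hk' : k ∈ F'
    · rw [D.inner_trunc_of_mem u hk', hW]
      by_cases hk : k ∈ F
      · rw [D.inner_trunc_of_mem u hk, sub_self, if_neg (by simp [hk])]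
      · rw [D.inner_trunc_of_notMem u hk, sub_zero, if_pos (by simp [hk, hk'])]
    · rw [D.inner_trunc_of_notMem u hk', D.inner_trunc_of_notMem u fun h => hk' (hF h), sub_zero,
        if_neg (by simp [hk'])]
  have h1 := (D.hasSum_inner (v - u) (D.trunc F' u - D.trunc F u)).unique
    (hasSum_sum_of_ne_finset_zero (s := F' \ F) fun k hk => by rw [hc, if_neg hk, mul_zero])
  rw [h1, Complex.re_sum]
  have h2 : ∀ k ∈ F' \ F, (conj (inner ℂ (D.b k) (v - u)) *
      inner ℂ (D.b k) (D.trunc F' u - D.trunc F u)).re ≤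
      (2 * N)⁻¹ * (D.w k ^ (2 : ℤ) * ‖inner ℂ (D.b k) v‖ ^ 2 +
        ‖inner ℂ (D.b k) (D.M (D.W F u))‖ ^ 2) := by
    intro k hk
    rw [hc, if_pos hk, inner_sub_right, hu k (Finset.mem_sdiff.1 hk).2, sub_zero]
    refine (Complex.re_le_norm _).trans ?_
    rw [norm_mul, RCLike.norm_conj]
    have hNk := hw k (Finset.mem_sdiff.1 hk).2
    set p := ‖inner ℂ (D.b k) v‖ with hp
    set q := ‖inner ℂ (D.b k) (D.M (D.W F u))‖
    have hp0 : 0 ≤ p := norm_nonneg _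
    have hq0 : 0 ≤ q := norm_nonneg _
    rw [inv_mul_eq_div, le_div_iff₀ (by positivity)]
    have e : D.w k ^ (2 : ℤ) = D.w k ^ 2 := by norm_cast
    rw [e]
    -- `2Npq ≤ 2(w p)q ≤ w²p² + q²`.
    nlinarith [sq_nonneg (D.w k * p - q), mul_le_mul_of_nonneg_right hNk (mul_nonneg hp0 hq0)]
  refine (Finset.sum_le_sum h2).trans ?_
  rw [← Finset.mul_sum, Finset.sum_add_distrib]
  refine mul_le_mul_of_nonneg_left (add_le_add ?_ ?_) (by positivity)
  · exact Finset.sum_le_sum_of_subset_of_nonneg Finset.sdiff_subset fun k _ _ =>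
      mul_nonneg (zpow_nonneg (D.w_pos k).le _) (sq_nonneg _)
  · refine (D.sum_sq_le _ _).trans ?_
    rw [← norm_sq_W, ← mul_pow]
    exact pow_le_pow_left₀ (norm_nonneg _) (D.M.le_opNorm _) 2

lemma inner_P_of_notMem {F : Finset ι} {k : ι} (hk : k ∉ F) (v : E) :
    inner ℂ (D.b k) (D.P F v) = 0 := D.inner_diag_of_notMem _ v hk

/-! ### Convergence of the Galerkin flows -/

variable [CompleteSpace E]

/-- The truncation has no component outside `F`, so those coefficients are frozen; in particular
data supported in `F` stay there. -/
lemma inner_flow_of_notMem {F : Finset ι} {k : ι} (hk : k ∉ F) (t : ℝ) (v : E) :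
    inner ℂ (D.b k) (D.flow F t v) = inner ℂ (D.b k) v := by
  have h := is_const_of_deriv_eq_zero (f := fun t => inner ℂ (D.b k) (D.flow F t v))
    (fun t => (D.hasDerivAt_inner_flow F v k t).differentiableAt)
    (fun t => by rw [(D.hasDerivAt_inner_flow F v k t).deriv, D.inner_trunc_of_notMem _ hk]) t 0
  simpa [flow_zero] using h

lemma en_two_flow_le {F S : Finset ι} {v : E} (hv : ∀ k ∉ S, inner ℂ (D.b k) v = 0) (hS : S ⊆ F)
    {t τ : ℝ} (ht : 0 ≤ t) (hτ : t ≤ τ) :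
    D.en 2 F (D.flow F t v) ≤ Real.exp (2 * D.K * τ) * D.en 2 S v := by
  have h : D.en 2 F v = D.en 2 S v := by
    symm
    refine Finset.sum_subset hS fun k _ hk => ?_
    rw [hv k hk]
    simp
  rw [← h]
  refine (D.en_flow_le (by norm_num) le_rfl F ht v).trans ?_
  refine mul_le_mul_of_nonneg_right (Real.exp_le_exp.2 ?_) (D.en_nonneg _ _ _)
  exact mul_le_mul_of_nonneg_left hτ (mul_nonneg zero_le_two D.K_nonneg)

/-- The difference `z = u' - u` solves `z' = trunc F' z + (trunc F' u - trunc F u)`. The first term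
is quasi-dissipative; the second is `O(1/N)` when paired with `z`, because `en 2` of both flows is
bounded by that of the finitely supported datum. Gronwall concludes. -/
lemma norm_flow_sub_flow_le {F F' S : Finset ι} (hS : S ⊆ F) (hF : F ⊆ F') {N : ℝ} (hN : 0 < N)
    (hw : ∀ k ∉ F, N ≤ D.w k) {v : E} (hv : ∀ k ∉ S, inner ℂ (D.b k) v = 0) {t : ℝ} (ht : 0 ≤ t) :
    ‖D.flow F' t v - D.flow F t v‖ ^ 2 ≤
      Real.exp (2 * D.K * t) * (N⁻¹ * ((1 + ‖D.M‖ ^ 2) *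
        (Real.exp (2 * D.K * t) * D.en 2 S v)) * t) := by
  have hd := fun s => hasDerivAt_norm_sq ((D.hasDerivAt_flow F' v s).sub (D.hasDerivAt_flow F v s))
  have hB : 0 ≤ Real.exp (2 * D.K * t) * D.en 2 S v :=
    mul_nonneg (Real.exp_pos _).le (D.en_nonneg _ _ _)
  have h := le_exp_mul_of_hasDerivAt_le (mul_nonneg zero_le_two D.K_nonneg)
    (c := N⁻¹ * ((1 + ‖D.M‖ ^ 2) * (Real.exp (2 * D.K * t) * D.en 2 S v)))
    (mul_nonneg (inv_nonneg.2 hN.le) (mul_nonneg (by positivity) hB)) hd (τ := t)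
    (fun s hs hst => by
      simp only [Pi.sub_apply]
      set u := D.flow F s v
      set u' := D.flow F' s v
      have e1 : D.trunc F' u' - D.trunc F u =
          D.trunc F' (u' - u) + (D.trunc F' u - D.trunc F u) := by
        rw [map_sub]; abel
      rw [e1, inner_add_right, Complex.add_re]
      have e2 := D.re_inner_trunc_self_le F' (u' - u)
      have e3 := D.re_inner_trunc_sub_le hF hN hw u u' fun k hk => by
        rw [D.inner_flow_of_notMem hk, hv k fun h => hk (hS h)]
      have e4 := D.en_two_flow_le hv hS hs hst
      have e5 := D.en_two_flow_le hv (hS.trans hF) hs hst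
      have e6 : D.en 2 F' u' + ‖D.M‖ ^ 2 * D.en 2 F u ≤
          (1 + ‖D.M‖ ^ 2) * (Real.exp (2 * D.K * t) * D.en 2 S v) := by
        nlinarith [mul_le_mul_of_nonneg_left e4 (sq_nonneg ‖D.M‖)]
      have e7 := mul_le_mul_of_nonneg_left e6 (inv_nonneg.2 hN.le)
      rw [mul_inv] at e3
      linarith) ht
  simpa [flow_zero] using h

lemma cauchySeq_flow_P {t : ℝ} (ht : 0 ≤ t) (m : ℕ) (v : E) :
    CauchySeq fun N => D.flow (D.lev N) t (D.P (D.lev m) v) := by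
  set C := Real.exp (2 * D.K * t) * ((1 + ‖D.M‖ ^ 2) *
        (Real.exp (2 * D.K * t) * D.en 2 (D.lev m) (D.P (D.lev m) v)) * t) with hC
  rw [Metric.cauchySeq_iff']
  intro ε hε
  -- Past level `N` the squared distance is at most `C / N`, so `N > C / ε²` suffices. The maximum
  -- with `m` keeps the datum inside the truncation, the one with `1` keeps `N` positive.
  obtain ⟨n, hn⟩ := exists_nat_gt (C / ε ^ 2)
  refine ⟨max (max m n) 1, fun K hK => ?_⟩
  set N := max (max m n) 1
  have hN1 : (1 : ℝ) ≤ N := by exact_mod_cast le_max_right _ _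
  have hN0 : (0 : ℝ) < N := by linarith
  have hNn : (n : ℝ) ≤ N := by exact_mod_cast (le_max_right m n).trans (le_max_left _ _)
  have h := D.norm_flow_sub_flow_le (D.lev_mono ((le_max_left m n).trans (le_max_left _ 1)))
    (D.lev_mono hK) hN0 (fun k hk => (not_le.1 fun h => hk (D.mem_lev.2 h)).le)
    (fun k hk => D.inner_P_of_notMem hk v) ht
  rw [dist_eq_norm]
  refine lt_of_pow_lt_pow_left₀ 2 hε.le (h.trans_lt ?_)
  have e : Real.exp (2 * D.K * t) * ((N : ℝ)⁻¹ * ((1 + ‖D.M‖ ^ 2) *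
        (Real.exp (2 * D.K * t) * D.en 2 (D.lev m) (D.P (D.lev m) v))) * t) = C / N := by
    rw [hC]; ring
  rw [e, div_lt_iff₀ hN0]
  rw [div_lt_iff₀ (by positivity)] at hn
  nlinarith [sq_nonneg ε]

/-- Finitely supported data are dense and the flows are bounded uniformly in `N`: a three-epsilon
argument. -/
lemma cauchySeq_flow {t : ℝ} (ht : 0 ≤ t) (v : E) : CauchySeq fun N => D.flow (D.lev N) t v := by
  rw [Metric.cauchySeq_iff']
  intro ε hε
  set c := Real.exp (D.K * t)
  have hc : 0 < c := Real.exp_pos _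
  obtain ⟨m, hm⟩ := ((Metric.tendsto_nhds.1 (D.tendsto_P v)) (ε / (3 * c)) (by positivity)).exists
  rw [dist_eq_norm, norm_sub_rev, lt_div_iff₀ (by positivity)] at hm
  obtain ⟨N, hN⟩ := Metric.cauchySeq_iff'.1 (D.cauchySeq_flow_P ht m v) (ε / 3) (by positivity)
  refine ⟨N, fun n hn => ?_⟩
  have h1 := hN n hn
  rw [dist_eq_norm] at h1 ⊢
  have e : D.flow (D.lev n) t v - D.flow (D.lev N) t v =
      (D.flow (D.lev n) t (D.P (D.lev m) v) - D.flow (D.lev N) t (D.P (D.lev m) v)) +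
      D.flow (D.lev n) t (v - D.P (D.lev m) v) - D.flow (D.lev N) t (v - D.P (D.lev m) v) := by
    rw [map_sub, map_sub]; abel
  rw [e]
  refine (norm_sub_le _ _).trans_lt ((add_le_add_left (norm_add_le _ _) _).trans_lt ?_)
  have h2 := D.norm_flow_apply_le (D.lev n) ht (v - D.P (D.lev m) v)
  have h3 := D.norm_flow_apply_le (D.lev N) ht (v - D.P (D.lev m) v)
  linarith

/-- Clamping the time at `0` makes the limit defined for every real `t`; convergence is only
available forward in time. -/
lemma exists_tendsto_flow (t : ℝ) (v : E) :
    ∃ y, Tendsto (fun N => D.flow (D.lev N) (max t 0) v) atTop (𝓝 y) :=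
  cauchySeq_tendsto_of_complete (D.cauchySeq_flow (le_max_right t 0) v)

/-- The semigroup generated by a dissipative system. -/
def T (t : ℝ) : E →L[ℂ] E :=
  continuousLinearMapOfTendsto (fun N => D.flow (D.lev N) (max t 0))
    (tendsto_pi_nhds.2 fun v => (D.exists_tendsto_flow t v).choose_spec)

lemma tendsto_flow {t : ℝ} (ht : 0 ≤ t) (v : E) :
    Tendsto (fun N => D.flow (D.lev N) t v) atTop (𝓝 (D.T t v)) := by
  have h : Tendsto (fun N => D.flow (D.lev N) (max t 0) v) atTop (𝓝 (D.T t v)) :=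
    (D.exists_tendsto_flow t v).choose_spec
  rwa [max_eq_left ht] at h

lemma norm_T_apply_le {t : ℝ} (ht : 0 ≤ t) (v : E) : ‖D.T t v‖ ≤ Real.exp (D.K * t) * ‖v‖ :=
  le_of_tendsto' (D.tendsto_flow ht v).norm fun _ => D.norm_flow_apply_le _ ht v

lemma T_zero : D.T 0 = ContinuousLinearMap.id ℂ E := by
  ext v
  refine tendsto_nhds_unique (D.tendsto_flow le_rfl v) (tendsto_const_nhds.congr fun _ => ?_)
  rw [flow_zero]
  rfl

lemma T_add {s t : ℝ} (hs : 0 ≤ s) (ht : 0 ≤ t) : D.T (s + t) = (D.T s).comp (D.T t) := by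
  ext v
  refine tendsto_nhds_unique (D.tendsto_flow (add_nonneg hs ht) v) ?_
  -- Both factors of the composition depend on `N`; the bound on `flow s` uniform in `N` allows the
  -- inner one to be replaced by its limit.
  have h1 : Tendsto (fun N => D.flow (D.lev N) s (D.flow (D.lev N) t v - D.T t v)) atTop (𝓝 0) := by
    refine squeeze_zero_norm (fun _ => D.norm_flow_apply_le _ hs _) ?_
    have h := ((D.tendsto_flow ht v).sub_const (D.T t v)).norm.const_mul (Real.exp (D.K * s))
    simpa using h
  have h2 := h1.add (D.tendsto_flow hs (D.T t v))
  rw [zero_add] at h2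
  refine h2.congr fun N => ?_
  rw [← map_add, sub_add_cancel, flow_add]
  rfl

end DissipativeSystem

namespace DissipativeSystem

variable {ι E : Type*} [NormedAddCommGroup E] [InnerProductSpace ℂ E] (D : DissipativeSystem ι E)

lemma exp_mul_le_exp_mul {s t : ℝ} (hst : s ≤ t) : Real.exp (D.K * s) ≤ Real.exp (D.K * t) :=
  Real.exp_le_exp.2 (mul_le_mul_of_nonneg_left hst D.K_nonneg)

lemma exists_norm_sub_G_lt (y : E) {ε : ℝ} (hε : 0 < ε) : ∃ x, ‖y - D.G x‖ < ε := by
  obtain ⟨N, hN⟩ := (Metric.tendsto_nhds.1 (D.tendsto_P y) ε hε).exists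
  refine ⟨D.W (D.lev N) y, ?_⟩
  rwa [G_W, ← dist_eq_norm, dist_comm]

lemma continuous_en (n : ℤ) (S : Finset ι) : Continuous (D.en n S) := by
  unfold en
  fun_prop

lemma en_mono {n : ℤ} {S F : Finset ι} (h : S ⊆ F) (v : E) : D.en n S v ≤ D.en n F v :=
  Finset.sum_le_sum_of_subset_of_nonneg h fun k _ _ =>
    mul_nonneg (zpow_nonneg (D.w_pos k).le _) (sq_nonneg _)

variable [CompleteSpace E]

/-! ### The generator of the limit semigroup -/

lemma norm_flow_sub_le (F : Finset ι) {t : ℝ} (ht : 0 ≤ t) (v : E) :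
    ‖D.flow F t v - v‖ ≤ Real.exp (D.K * t) * ‖D.trunc F v‖ * t := by
  have h := norm_image_sub_le_of_norm_deriv_le_segment' (f := fun s => D.flow F s v) (a := 0)
    (b := t) (C := Real.exp (D.K * t) * ‖D.trunc F v‖)
    (fun s _ => (D.hasDerivAt_flow' F v s).hasDerivWithinAt)
    (fun s hs => (D.norm_flow_apply_le F hs.1 _).trans (mul_le_mul_of_nonneg_right
      (D.exp_mul_le_exp_mul hs.2.le) (norm_nonneg _))) t (Set.right_mem_Icc.2 ht)
  simpa [flow_zero] using h

/-- First order Taylor remainder, uniform in `F`. Here `y` stands for the limit of `trunc F v`; as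
it need not lie in the domain, `G x` serves as a regular approximation of it whose motion is `O(t)`.
-/
lemma norm_flow_sub_sub_le (F : Finset ι) {t : ℝ} (ht : 0 ≤ t) (v y x : E) :
    ‖D.flow F t v - v - (t : ℂ) • y‖ ≤ (Real.exp (D.K * t) * ‖D.trunc F v - y‖ +
      ((Real.exp (D.K * t) + 1) * ‖y - D.G x‖ +
        Real.exp (D.K * t) * (‖D.M‖ * ‖x‖) * t)) * t := by
  have hd : ∀ s : ℝ, HasDerivAt (fun s : ℝ => D.flow F s v - s • y)
      (D.flow F s (D.trunc F v) - y) s := fun s => by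
    have h := (D.hasDerivAt_flow' F v s).sub ((hasDerivAt_id s).smul_const y)
    rwa [one_smul] at h
  have h := norm_image_sub_le_of_norm_deriv_le_segment' (f := fun s : ℝ => D.flow F s v - s • y)
    (a := 0) (b := t) (fun s _ => (hd s).hasDerivWithinAt) (C := Real.exp (D.K * t) *
      ‖D.trunc F v - y‖ + ((Real.exp (D.K * t) + 1) * ‖y - D.G x‖ +
        Real.exp (D.K * t) * (‖D.M‖ * ‖x‖) * t))
    (fun s hs => by
      have e : D.flow F s (D.trunc F v) - y = D.flow F s (D.trunc F v - y) +
          (D.flow F s (y - D.G x) + (D.G x - y) + (D.flow F s (D.G x) - D.G x)) := by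
        rw [map_sub, map_sub]; abel
      have hE := D.exp_mul_le_exp_mul hs.2.le
      have e1 : ‖D.flow F s (D.trunc F v - y)‖ ≤ Real.exp (D.K * t) * ‖D.trunc F v - y‖ :=
        (D.norm_flow_apply_le F hs.1 _).trans (mul_le_mul_of_nonneg_right hE (norm_nonneg _))
      have e2 : ‖D.flow F s (y - D.G x) + (D.G x - y)‖ ≤
          (Real.exp (D.K * t) + 1) * ‖y - D.G x‖ := by
        refine (norm_add_le _ _).trans ?_
        rw [norm_sub_rev (D.G x) y, add_mul, one_mul]
        exact add_le_add_left ((D.norm_flow_apply_le F hs.1 _).trans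
          (mul_le_mul_of_nonneg_right hE (norm_nonneg _))) _
      have e3 : ‖D.flow F s (D.G x) - D.G x‖ ≤ Real.exp (D.K * t) * (‖D.M‖ * ‖x‖) * t := by
        refine (D.norm_flow_sub_le F hs.1 _).trans ?_
        exact mul_le_mul (mul_le_mul hE (D.norm_trunc_G_le F x) (norm_nonneg _)
          (Real.exp_pos _).le) hs.2.le hs.1 (by positivity)
      rw [e]
      exact (norm_add_le _ _).trans (add_le_add e1 ((norm_add_le _ _).trans (add_le_add e2 e3))))
    t (Set.right_mem_Icc.2 ht)
  simp only [flow_zero, zero_smul, sub_zero, one_apply_eq_self] at h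
  rw [sub_right_comm]
  exact h

lemma norm_T_G_sub_le {t : ℝ} (ht : 0 ≤ t) (x : E) :
    ‖D.T t (D.G x) - D.G x‖ ≤ Real.exp (D.K * t) * ‖D.M x‖ * t :=
  le_of_tendsto_of_tendsto' ((D.tendsto_flow ht _).sub_const _).norm
    (((D.tendsto_trunc_G x).norm.const_mul _).mul_const _)
    fun _ => D.norm_flow_sub_le _ ht _

lemma norm_T_G_sub_sub_le {t : ℝ} (ht : 0 ≤ t) (x x' : E) :
    ‖D.T t (D.G x) - D.G x - (t : ℂ) • D.M x‖ ≤
      ((Real.exp (D.K * t) + 1) * ‖D.M x - D.G x'‖ +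
        Real.exp (D.K * t) * (‖D.M‖ * ‖x'‖) * t) * t := by
  have h := le_of_tendsto_of_tendsto'
    (((D.tendsto_flow ht (D.G x)).sub_const (D.G x)).sub_const ((t : ℂ) • D.M x)).norm
    (((((D.tendsto_trunc_G x).sub_const (D.M x)).norm.const_mul (Real.exp (D.K * t))).add_const
      ((Real.exp (D.K * t) + 1) * ‖D.M x - D.G x'‖ +
        Real.exp (D.K * t) * (‖D.M‖ * ‖x'‖) * t)).mul_const t)
    fun _ => D.norm_flow_sub_sub_le _ ht (D.G x) (D.M x) x'
  simpa using h

lemma tendsto_T_zero (v : E) : Tendsto (fun t => D.T t v) (𝓝[>] 0) (𝓝 v) := by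
  rw [Metric.tendsto_nhds]
  intro ε hε
  -- As `t ↓ 0` the error bound tends to `2 * ‖v - G x‖`, which is then below `ε / 2`.
  obtain ⟨x, hx⟩ := D.exists_norm_sub_G_lt v (ε := ε / 4) (by positivity)
  have hlim : Tendsto (fun t : ℝ => (Real.exp (D.K * t) + 1) * ‖v - D.G x‖ +
      Real.exp (D.K * t) * ‖D.M x‖ * t) (𝓝[>] 0) (𝓝 (2 * ‖v - D.G x‖)) := by
    have : Continuous fun t : ℝ => (Real.exp (D.K * t) + 1) * ‖v - D.G x‖ +
      Real.exp (D.K * t) * ‖D.M x‖ * t := by fun_prop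
    convert (this.tendsto 0).mono_left nhdsWithin_le_nhds using 2
    simp
    norm_num
  filter_upwards [hlim.eventually_lt_const (show 2 * ‖v - D.G x‖ < ε by linarith),
    self_mem_nhdsWithin] with t h1 ht
  have ht : 0 ≤ t := le_of_lt ht
  rw [dist_eq_norm]
  have e : D.T t v - v = D.T t (v - D.G x) + (D.G x - v) + (D.T t (D.G x) - D.G x) := by
    rw [map_sub]; abel
  rw [e]
  refine lt_of_le_of_lt ((norm_add_le _ _).trans (add_le_add (norm_add_le _ _)
    (D.norm_T_G_sub_le ht x))) ?_
  rw [norm_sub_rev (D.G x) v]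
  linarith [D.norm_T_apply_le ht (v - D.G x)]

lemma tendsto_difference_quotient (x : E) :
    Tendsto (fun t : ℝ => (t⁻¹ : ℂ) • (D.T t (D.G x) - D.G x)) (𝓝[>] 0) (𝓝 (D.M x)) := by
  rw [Metric.tendsto_nhds]
  intro ε hε
  obtain ⟨x', hx⟩ := D.exists_norm_sub_G_lt (D.M x) (ε := ε / 4) (by positivity)
  have hlim : Tendsto (fun t : ℝ => (Real.exp (D.K * t) + 1) * ‖D.M x - D.G x'‖ +
      Real.exp (D.K * t) * (‖D.M‖ * ‖x'‖) * t) (𝓝[>] 0) (𝓝 (2 * ‖D.M x - D.G x'‖)) := by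
    have : Continuous fun t : ℝ => (Real.exp (D.K * t) + 1) * ‖D.M x - D.G x'‖ +
      Real.exp (D.K * t) * (‖D.M‖ * ‖x'‖) * t := by fun_prop
    convert (this.tendsto 0).mono_left nhdsWithin_le_nhds using 2
    simp
    norm_num
  filter_upwards [hlim.eventually_lt_const (show 2 * ‖D.M x - D.G x'‖ < ε by linarith),
    self_mem_nhdsWithin] with t h1 ht
  have ht : 0 < t := ht
  have htc : (t : ℂ) ≠ 0 := by exact_mod_cast ht.ne'
  have e : (t⁻¹ : ℂ) • (D.T t (D.G x) - D.G x) - D.M x =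
      (t⁻¹ : ℂ) • (D.T t (D.G x) - D.G x - (t : ℂ) • D.M x) := by
    rw [smul_sub _ (_ - _), smul_smul, inv_mul_cancel₀ htc, one_smul]
  rw [dist_eq_norm, e, norm_smul, norm_inv, Complex.norm_real, Real.norm_of_nonneg ht.le,
    inv_mul_lt_iff₀ ht]
  refine (D.norm_T_G_sub_sub_le ht.le x x').trans_lt ?_
  rw [mul_comm]
  exact mul_lt_mul_of_pos_left h1 ht

/-- Smoothing survives the limit by lower semicontinuity: for fixed finite `S` the energy is
continuous, and `S` is eventually contained in `lev N`. -/
lemma sq_mul_en_T_le {n : ℤ} (h1 : -2 ≤ n) (h2 : n ≤ 0) {t : ℝ} (ht : 0 ≤ t) {v : E} {R : ℝ}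
    (hR : ∀ F, D.en n F v ≤ R ^ 2) (S : Finset ι) :
    t ^ 2 * D.en (n + 2) S (D.T t v) ≤ (Real.exp (D.K * t) * R) ^ 2 := by
  refine le_of_tendsto
    ((((D.continuous_en (n + 2) S).tendsto _).comp (D.tendsto_flow ht v)).const_mul (t ^ 2)) ?_
  filter_upwards [D.tendsto_lev.eventually_ge_atTop S] with N hN
  refine (mul_le_mul_of_nonneg_left (D.en_mono hN _) (sq_nonneg t)).trans
    ((D.sq_mul_en_flow_le h1 h2 (D.lev N) ht v).trans ?_)
  rw [mul_pow, ← Real.exp_nat_mul]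
  have e : ((2 : ℕ) : ℝ) * (D.K * t) = 2 * D.K * t := by push_cast; ring
  rw [e]
  exact mul_le_mul_of_nonneg_left (hR _) (Real.exp_pos _).le

lemma exists_T_eq_G {t : ℝ} (ht : 0 < t) (v : E) :
    ∃ x, D.T t v = D.G x ∧ ‖x‖ ≤ Real.exp (D.K * t) * ‖v‖ / t := by
  refine D.exists_G_eq (by positivity) fun S => ?_
  have h := D.sq_mul_en_T_le (n := 0) (by norm_num) le_rfl ht.le (fun F => D.en_zero_le F v) S
  rw [div_pow, le_div_iff₀ (by positivity), mul_comm]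
  exact h

/-- Smoothing from `n = -2` to `0`: the energy of order `-2` is dominated by `‖G v‖²`. This is the
endpoint `γ = 1` for short times. -/
lemma norm_T_le_norm_G {t : ℝ} (ht : 0 < t) (v : E) :
    ‖D.T t v‖ ≤ Real.exp (D.K * t) / t * ‖D.G v‖ := by
  refine le_of_sq_le_sq (D.norm_sq_le_of_sum_le fun S => ?_) (by positivity)
  have h := D.sq_mul_en_T_le (n := -2) le_rfl (by norm_num) ht.le (fun F => D.en_neg_two_le F v) S
  rw [div_mul_eq_mul_div, div_pow, le_div_iff₀ (by positivity), mul_comm]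
  simpa [en] using h

lemma T_comm {s t : ℝ} (hs : 0 ≤ s) (ht : 0 ≤ t) (v : E) : D.T s (D.T t v) = D.T t (D.T s v) := by
  rw [← ContinuousLinearMap.comp_apply, ← ContinuousLinearMap.comp_apply, ← D.T_add hs ht,
    ← D.T_add ht hs, add_comm]

/-- The generator of the semigroup is `G x ↦ M x` with domain the range of `G`. -/
theorem tendsto_iff_exists_G (v y : E) :
    Tendsto (fun t : ℝ => (t⁻¹ : ℂ) • (D.T t v - v)) (𝓝[>] 0) (𝓝 y) ↔
      ∃ x, v = D.G x ∧ D.M x = y := by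
  refine ⟨fun h => ?_, ?_⟩
  -- `T τ` commutes with difference quotients, so the regularised vector `T τ v`, which lies in the
  -- domain, has generator value `T τ y`.
  · have key : ∀ τ : ℝ, 0 < τ → ∀ x, D.T τ v = D.G x → D.M x = D.T τ y := by
      intro τ hτ x hx
      have h1 := D.tendsto_difference_quotient x
      refine tendsto_nhds_unique h1 ?_
      have h2 := ((D.T τ).continuous.tendsto y).comp h
      refine h2.congr' ?_
      filter_upwards [self_mem_nhdsWithin] with t ht
      rw [Function.comp_apply, map_smul, map_sub, D.T_comm hτ.le (le_of_lt ht), hx]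
    -- The elliptic estimate for `G x = T τ v`, `M x = T τ y`, `τ < 1` bounds `‖x‖` by this `R`
    -- independently of `τ`. Letting `τ ↓ 0` bounds `en 2 S v` for all `S`, which places `v` in the
    -- range of `G`.
    set R := Real.exp D.K * ‖y‖ + D.K * (Real.exp D.K * ‖v‖) with hR
    have hR0 : 0 ≤ R := add_nonneg (by positivity) (mul_nonneg D.K_nonneg (by positivity))
    have hbd : ∀ᶠ τ in 𝓝[>] (0 : ℝ), ∀ S, D.en 2 S (D.T τ v) ≤ R ^ 2 := by
      filter_upwards [Ioo_mem_nhdsGT (zero_lt_one' ℝ)] with τ hτ S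
      obtain ⟨x, hx, -⟩ := D.exists_T_eq_G hτ.1 v
      rw [hx]
      refine (D.en_two_G_le S x).trans (pow_le_pow_left₀ (norm_nonneg _) ?_ 2)
      have h3 := D.norm_le_of_elliptic x
      rw [key τ hτ.1 x hx, ← hx] at h3
      have h4 : ∀ z, ‖D.T τ z‖ ≤ Real.exp D.K * ‖z‖ := fun z =>
        (D.norm_T_apply_le hτ.1.le z).trans (mul_le_mul_of_nonneg_right
          (by simpa using D.exp_mul_le_exp_mul hτ.2.le) (norm_nonneg _))
      exact h3.trans (add_le_add (h4 y) (mul_le_mul_of_nonneg_left (h4 v) D.K_nonneg))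
    obtain ⟨x, hx, -⟩ := D.exists_G_eq (v := v) hR0 fun S =>
      le_of_tendsto (((D.continuous_en 2 S).tendsto v).comp (D.tendsto_T_zero v))
        (hbd.mono fun τ hτ => hτ S)
    refine ⟨x, hx, ?_⟩
    rw [hx] at h
    exact tendsto_nhds_unique (D.tendsto_difference_quotient x) h
  · rintro ⟨x, rfl, rfl⟩
    exact D.tendsto_difference_quotient x

end DissipativeSystem

namespace DissipativeSystem

variable {ι E : Type*} [NormedAddCommGroup E] [InnerProductSpace ℂ E] (D : DissipativeSystem ι E)

/-! ### Compactness and the growth bound -/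

lemma isCompactOperator_P (F : Finset ι) : IsCompactOperator (D.P F) := by
  have h : D.P F ∈ compactOperator (RingHom.id ℂ) E E := by
    refine Submodule.sum_mem _ fun k _ => Submodule.smul_mem _ _ ?_
    have h1 : IsCompactOperator (ContinuousLinearMap.toSpanSingleton ℂ (D.b k)) :=
      isCompactOperator_of_locallyCompactSpace_rng _
    exact h1.comp_clm (innerSL ℂ (D.b k))
  exact h

/-- Outside `lev N` the weights exceed `N`, so `G` is a norm limit of finite rank operators. -/
lemma norm_G_sub_P_le {N : ℕ} (hN : 0 < N) (x : E) :
    ‖D.G x - D.P (D.lev N) (D.G x)‖ ≤ ‖x‖ / N := by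
  classical
  refine le_of_sq_le_sq (D.norm_sq_le_of_sum_le fun S => ?_) (by positivity)
  rw [div_pow, le_div_iff₀ (by positivity), Finset.sum_mul]
  refine le_trans (Finset.sum_le_sum fun k _ => ?_) (D.sum_sq_le S x)
  rw [← mul_pow]
  refine pow_le_pow_left₀ (by positivity) ?_ 2
  by_cases hk : k ∈ D.lev N
  · rw [inner_sub_right, P, D.inner_diag_of_mem _ _ hk]
    simp
  · rw [inner_sub_right, D.inner_P_of_notMem hk, sub_zero, D.inner_G, norm_mul, norm_inv,
      Complex.norm_real, Real.norm_of_nonneg (D.w_pos k).le, mul_assoc,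
      inv_mul_le_iff₀ (D.w_pos k), mul_comm]
    rw [mem_lev, not_le] at hk
    exact mul_le_mul_of_nonneg_right hk.le (norm_nonneg _)

variable [CompleteSpace E]

/-- `T 1` sends the unit ball into `G` of a bounded set, so the finite rank operators `P (lev N) ∘ T
1` converge to it in norm. -/
lemma isCompactOperator_T_one : IsCompactOperator (D.T 1) := by
  refine isCompactOperator_of_tendsto (l := atTop) (F := fun N : ℕ => D.P (D.lev N) ∘L D.T 1) ?_
    (Eventually.of_forall fun N => (D.isCompactOperator_P _).comp_clm (D.T 1))
  rw [tendsto_iff_norm_sub_tendsto_zero]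
  refine squeeze_zero' (Eventually.of_forall fun _ => norm_nonneg _) ?_
    (tendsto_const_div_atTop_nhds_zero_nat (Real.exp D.K))
  filter_upwards [eventually_gt_atTop 0] with N hN
  refine ContinuousLinearMap.opNorm_le_bound _ (by positivity) fun v => ?_
  obtain ⟨x, hx, hx'⟩ := D.exists_T_eq_G one_pos v
  rw [sub_apply, ContinuousLinearMap.comp_apply, hx, norm_sub_rev]
  refine (D.norm_G_sub_P_le hN x).trans ?_
  rw [div_mul_eq_mul_div]
  refine div_le_div_of_nonneg_right ?_ (Nat.cast_nonneg N)
  simpa using hx'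

/-- Along the truncated flow, `e^{-νs} flow s (G x)` has derivative `e^{-νs} flow s (trunc (G x) - ν
G x)`, and `trunc (G x) - ν G x` tends to `M x - ν G x = 0`. -/
lemma T_one_apply_of_eigenvector {x : E} {ν : ℂ} (h : D.M x = ν • D.G x) :
    D.T 1 (D.G x) = Complex.exp ν • D.G x := by
  have hbd : ∀ N, ‖Complex.exp (-ν) • D.flow (D.lev N) 1 (D.G x) - D.G x‖ ≤
      Real.exp ‖ν‖ * (Real.exp D.K * ‖D.trunc (D.lev N) (D.G x) - ν • D.G x‖) := by
    intro N
    set F := D.lev N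
    set v := D.G x
    have hd : ∀ s : ℝ, HasDerivAt (fun s : ℝ => Complex.exp (-ν * s) • D.flow F s v)
        (Complex.exp (-ν * s) • D.flow F s (D.trunc F v - ν • v)) s := by
      intro s
      have h1 : HasDerivAt (fun s : ℝ => Complex.exp (-ν * s)) (Complex.exp (-ν * s) * -ν) s := by
        have := (((hasDerivAt_id (s : ℂ)).const_mul (-ν)).cexp).comp_ofReal
        simpa using this
      refine (h1.smul (D.hasDerivAt_flow' F v s)).congr_deriv ?_
      rw [map_sub, map_smul]
      module
    have h2 := norm_image_sub_le_of_norm_deriv_le_segment' (a := 0) (b := 1)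
      (fun s _ => (hd s).hasDerivWithinAt)
      (C := Real.exp ‖ν‖ * (Real.exp D.K * ‖D.trunc F v - ν • v‖))
      (fun s hs => by
        rw [norm_smul, Complex.norm_exp]
        refine mul_le_mul (Real.exp_le_exp.2 ?_) ((D.norm_flow_apply_le F hs.1 _).trans
          (mul_le_mul_of_nonneg_right ?_ (norm_nonneg _))) (norm_nonneg _) (Real.exp_pos _).le
        · refine (Complex.re_le_norm _).trans ?_
          rw [norm_mul, norm_neg, Complex.norm_real, Real.norm_of_nonneg hs.1]
          exact mul_le_of_le_one_right (norm_nonneg _) hs.2.le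
        · simpa using D.exp_mul_le_exp_mul hs.2.le) 1 (Set.right_mem_Icc.2 zero_le_one)
    simpa [flow_zero] using h2
  have hlim : Tendsto (fun N => Real.exp ‖ν‖ *
      (Real.exp D.K * ‖D.trunc (D.lev N) (D.G x) - ν • D.G x‖)) atTop (𝓝 0) := by
    have h1 := (((D.tendsto_trunc_G x).sub_const (ν • D.G x)).norm.const_mul
      (Real.exp D.K)).const_mul (Real.exp ‖ν‖)
    simpa [h] using h1
  have h3 := le_of_tendsto_of_tendsto'
    (((D.tendsto_flow zero_le_one (D.G x)).const_smul (Complex.exp (-ν))).sub_const (D.G x)).norm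
    hlim hbd
  have h4 : Complex.exp (-ν) • D.T 1 (D.G x) = D.G x := by
    rw [← sub_eq_zero, ← norm_eq_zero]
    exact le_antisymm h3 (norm_nonneg _)
  rw [← h4, smul_smul, ← Complex.exp_add, add_neg_cancel, Complex.exp_zero, one_smul, h4]

/-- The generator commutes with `T 1`, hence preserves its eigenspaces. -/
lemma T_one_M {x : E} {z : ℂ} (h : D.T 1 (D.G x) = z • D.G x) : D.T 1 (D.M x) = z • D.M x := by
  refine tendsto_nhds_unique (((D.T 1).continuous.tendsto _).comp (D.tendsto_difference_quotient x))
    (((D.tendsto_difference_quotient x).const_smul z).congr' ?_)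
  filter_upwards [self_mem_nhdsWithin] with t ht
  rw [Function.comp_apply, map_smul, map_sub, D.T_comm zero_le_one (le_of_lt ht), h, map_smul,
    smul_comm, smul_sub z]

/-- The spectral mapping theorem for the point spectrum of the time one map. -/
lemma exists_eigenvalue_of_T_one {z : ℂ} (hz : z ≠ 0)
    (h : Module.End.HasEigenvalue (D.T 1 : Module.End ℂ E) z) :
    ∃ (ν : ℂ) (x : E), x ≠ 0 ∧ D.M x = ν • D.G x ∧ z = Complex.exp ν := by
  set V := Module.End.eigenspace (D.T 1 : Module.End ℂ E) z with hV
  have hmem : ∀ v, v ∈ V ↔ D.T 1 v = z • v := fun v => Module.End.mem_eigenspace_iff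
  have hclosed : IsClosed (V : Set E) := by
    have : (V : Set E) = {v | D.T 1 v = z • v} := Set.ext hmem
    rw [this]
    exact isClosed_eq (D.T 1).continuous (continuous_const_smul z)
  have hinv : ∀ v ∈ V, (D.T 1 : Module.End ℂ E) v ∈ V := fun v hv => by
    have : (D.T 1 : Module.End ℂ E) v = z • v := (hmem v).1 hv
    rw [this]
    exact V.smul_mem z hv
  -- On `V` the compact operator `T 1` is `z` times the identity, and `z ≠ 0`.
  have hfin : FiniteDimensional ℂ V := by
    refine FiniteDimensional.of_isCompactOperator_id ?_
    have h1 : IsCompactOperator ((D.T 1 : Module.End ℂ E).restrict hinv) :=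
      IsCompactOperator.restrict (f := (D.T 1 : Module.End ℂ E)) D.isCompactOperator_T_one hinv
        hclosed
    have h2 := h1.smul z⁻¹
    refine (congrArg IsCompactOperator (funext fun v => ?_)).mp h2
    refine Subtype.ext ?_
    have := (hmem v).1 v.2
    simp [LinearMap.restrict_apply, this, smul_smul, inv_mul_cancel₀ hz]
  have hnt : Nontrivial V := (Submodule.nontrivial_iff_ne_bot).2 h
  let U : Submodule ℂ E := V.comap (D.G : E →ₗ[ℂ] E)
  let g : U →ₗ[ℂ] V := (D.G : E →ₗ[ℂ] E).restrict fun x hx => hx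
  -- Each `v ∈ V` equals `T 1 (z⁻¹ v)`, so the whole eigenspace lies in the domain. Hence the
  -- generator `M G⁻¹` acts on the nonzero finite dimensional complex space `V` and has an
  -- eigenvector there.
  have hg : Function.Bijective g := by
    refine ⟨fun x y hxy => Subtype.ext (D.G_injective (congrArg Subtype.val hxy)), fun v => ?_⟩
    obtain ⟨x, hx, -⟩ := D.exists_T_eq_G one_pos (z⁻¹ • (v : E))
    rw [map_smul, (hmem v).1 v.2, smul_smul, inv_mul_cancel₀ hz, one_smul] at hx
    exact ⟨⟨x, show D.G x ∈ V from hx ▸ v.2⟩, Subtype.ext hx.symm⟩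
  let e := LinearEquiv.ofBijective g hg
  let m : U →ₗ[ℂ] V := (D.M : E →ₗ[ℂ] E).restrict fun x hx =>
    (hmem _).2 (D.T_one_M ((hmem _).1 hx))
  obtain ⟨ν, hν⟩ := Module.End.exists_eigenvalue (m ∘ₗ (e.symm : V →ₗ[ℂ] U))
  obtain ⟨φ, hφ, hφ0⟩ := hν.exists_hasEigenvector
  obtain ⟨x, rfl⟩ := e.surjective φ
  have hM : D.M x = ν • D.G x := by
    have h1 := Module.End.mem_eigenspace_iff.1 hφ
    rw [LinearMap.comp_apply, LinearEquiv.coe_coe, e.symm_apply_apply] at h1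
    exact congrArg Subtype.val h1
  have hx0 : (x : E) ≠ 0 := fun h0 => hφ0 (by
    rw [Submodule.coe_eq_zero] at h0
    rw [h0, map_zero])
  have hG0 : D.G x ≠ 0 := fun h0 => hx0 (D.G_injective (by rw [h0, map_zero]))
  refine ⟨ν, x, hx0, hM, ?_⟩
  have h1 := D.T_one_apply_of_eigenvector hM
  have h2 : D.T 1 (D.G x) = z • D.G x := (hmem _).1 x.2
  rw [h2] at h1
  exact smul_left_injective ℂ hG0 h1

lemma spectralRadius_T_one_le {a : ℝ} (ha : ∀ (ν : ℂ) (x : E), x ≠ 0 → D.M x = ν • D.G x → ν.re ≤ a) :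
    spectralRadius ℂ (D.T 1) ≤ ENNReal.ofReal (Real.exp a) := by
  refine iSup₂_le fun z hz => ?_
  by_cases hz0 : z = 0
  · simp [hz0]
  obtain ⟨ν, x, hx, hM, rfl⟩ := D.exists_eigenvalue_of_T_one hz0
    ((D.isCompactOperator_T_one.hasEigenvalue_iff_mem_spectrum hz0).2 hz)
  rw [← enorm_eq_nnnorm, ← ofReal_norm, Complex.norm_exp]
  exact ENNReal.ofReal_le_ofReal (Real.exp_le_exp.2 (ha ν x hx hM))

lemma T_one_pow (n : ℕ) : D.T 1 ^ n = D.T n := by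
  induction n with
  | zero => rw [pow_zero, Nat.cast_zero, T_zero]; rfl
  | succ n ih => rw [pow_succ, ih, Nat.cast_succ, D.T_add (Nat.cast_nonneg n) zero_le_one]; rfl

/-- Gelfand's formula: `‖(T 1)^n‖^{1/n}` eventually drops below `e^{a'}`; a single such `n` is
enough. -/
lemma exists_norm_T_nat_le {a a' : ℝ} (ha : ∀ (ν : ℂ) (x : E), x ≠ 0 → D.M x = ν • D.G x → ν.re ≤ a)
    (haa' : a < a') : ∃ n : ℕ, 0 < n ∧ ‖D.T n‖ ≤ Real.exp (a' * n) := by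
  have h1 := spectrum.pow_norm_pow_one_div_tendsto_nhds_spectralRadius (D.T 1)
  have h2 : spectralRadius ℂ (D.T 1) < ENNReal.ofReal (Real.exp a') :=
    (D.spectralRadius_T_one_le ha).trans_lt
      ((ENNReal.ofReal_lt_ofReal_iff (Real.exp_pos _)).2 (Real.exp_lt_exp.2 haa'))
  obtain ⟨n, hn, hn0⟩ := ((h1.eventually_lt_const h2).and (eventually_gt_atTop 0)).exists
  refine ⟨n, hn0, ?_⟩
  rw [ENNReal.ofReal_lt_ofReal_iff (Real.exp_pos _), T_one_pow] at hn
  have hn' : (n : ℝ) ≠ 0 := by exact_mod_cast hn0.ne'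
  have h3 := Real.rpow_le_rpow (by positivity) hn.le (Nat.cast_nonneg n)
  rwa [← Real.rpow_mul (norm_nonneg _), one_div, inv_mul_cancel₀ hn', Real.rpow_one,
    ← Real.exp_mul] at h3

/-- The growth bound of the semigroup is the spectral bound of its generator. -/
theorem exists_norm_T_le {a a' : ℝ} (ha : ∀ (ν : ℂ) (x : E), x ≠ 0 → D.M x = ν • D.G x → ν.re ≤ a)
    (haa' : a < a') :
    ∃ C, 0 < C ∧ ∀ t, 0 ≤ t → ∀ v, ‖D.T t v‖ ≤ C * Real.exp (a' * t) * ‖v‖ := by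
  obtain ⟨n, hn0, hn⟩ := D.exists_norm_T_nat_le ha haa'
  have hn0' : (0 : ℝ) < n := by exact_mod_cast hn0
  have hiter : ∀ m : ℕ, ∀ s, 0 ≤ s → ∀ v,
      ‖D.T (m * n + s) v‖ ≤ Real.exp (a' * (m * n)) * (Real.exp (D.K * s) * ‖v‖) := by
    intro m s hs v
    induction m with
    | zero => simpa using D.norm_T_apply_le hs v
    | succ m ih =>
      have e : ((m + 1 : ℕ) : ℝ) * n + s = n + (m * n + s) := by push_cast; ring
      rw [e, D.T_add hn0'.le (by positivity), ContinuousLinearMap.comp_apply]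
      refine ((D.T n).le_opNorm _).trans ((mul_le_mul hn ih (norm_nonneg _)
        (Real.exp_pos _).le).trans_eq ?_)
      rw [← mul_assoc, ← Real.exp_add]
      congr 2
      push_cast
      ring
  -- Write `t = m n + s` with `0 ≤ s < n`. The factor `e^{Kn}` pays for the leftover time `s`, and
  -- `e^{|a'|n}` for replacing `e^{a'mn}` by `e^{a't}`.
  refine ⟨Real.exp (|a'| * n + D.K * n), Real.exp_pos _, fun t ht v => ?_⟩
  set m := ⌊t / n⌋₊
  have h1 : m * (n : ℝ) ≤ t := by
    rw [← le_div_iff₀ hn0']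
    exact Nat.floor_le (by positivity)
  have h2 : t < (m + 1) * n := by
    rw [← div_lt_iff₀ hn0']
    exact Nat.lt_floor_add_one _
  have h3 := hiter m (t - m * n) (by linarith) v
  rw [add_sub_cancel] at h3
  refine h3.trans ?_
  rw [← mul_assoc, ← Real.exp_add, ← Real.exp_add]
  refine mul_le_mul_of_nonneg_right (Real.exp_le_exp.2 ?_) (norm_nonneg _)
  have h4 : D.K * (t - m * n) ≤ D.K * n := mul_le_mul_of_nonneg_left (by linarith) D.K_nonneg
  have h5 : -a' * (t - m * n) ≤ |a'| * n :=
    mul_le_mul (neg_le_abs a') (by linarith) (by linarith) (abs_nonneg _)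
  linarith

/-! ### Interpolation between the uniform bound and the smoothing bound. -/

lemma rpow_interpolation {N X Y C₀ C₁ t γ : ℝ} (hN : 0 ≤ N) (hX : 0 ≤ X) (hY : 0 ≤ Y)
    (hC₀ : 0 < C₀) (hC₁ : 0 < C₁) (ht : 0 < t) (h₀ : N ≤ C₀ * X) (h₁ : N ≤ C₁ / t * Y)
    (hγ₀ : 0 ≤ γ) (hγ₁ : γ ≤ 1) :
    N ≤ C₀ ^ (1 - γ) * C₁ ^ γ / t ^ γ * X ^ (1 - γ) * Y ^ γ := by
  have hγ : 0 ≤ 1 - γ := sub_nonneg.2 hγ₁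
  calc N = N ^ (1 - γ) * N ^ γ := by
        rw [← Real.rpow_add_of_nonneg hN hγ hγ₀, sub_add_cancel, Real.rpow_one]
    _ ≤ (C₀ * X) ^ (1 - γ) * (C₁ / t * Y) ^ γ :=
        mul_le_mul (Real.rpow_le_rpow hN h₀ hγ) (Real.rpow_le_rpow hN h₁ hγ₀)
          (Real.rpow_nonneg hN _) (Real.rpow_nonneg (by positivity) _)
    _ = C₀ ^ (1 - γ) * C₁ ^ γ / t ^ γ * X ^ (1 - γ) * Y ^ γ := by
        rw [Real.mul_rpow hC₀.le hX, Real.mul_rpow (by positivity) hY,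
          Real.div_rpow hC₁.le ht.le]
        ring

/-- Smoothing and decay of an exponentially stable semigroup. -/
theorem exists_norm_T_le_rpow {δ : ℝ} (hδ : 0 < δ)
    (ha : ∀ (ν : ℂ) (x : E), x ≠ 0 → D.M x = ν • D.G x → ν.re ≤ -δ) {γ : ℝ} (hγ₀ : 0 ≤ γ) (hγ₁ : γ ≤ 1) :
    ∃ C, 0 < C ∧ ∀ v, ∀ t, 0 < t →
      ‖D.T t v‖ ≤ C / t ^ γ * ‖v‖ ^ (1 - γ) * ‖D.G v‖ ^ γ := by
  obtain ⟨C₀, hC₀, h⟩ := D.exists_norm_T_le ha (a' := -(δ / 2)) (by linarith)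
  -- The first summand serves `t ≤ 1`. The second serves `t ≥ 1`, where `t * e^{-δ(t-1)/2} ≤ e^{δ/2}
  -- * (2/δ)`.
  set C₁ := Real.exp D.K + C₀ * Real.exp (δ / 2) * (2 / δ) * Real.exp D.K
  have hC₁ : 0 < C₁ := by positivity
  refine ⟨C₀ ^ (1 - γ) * C₁ ^ γ, by positivity, fun v t ht =>
    rpow_interpolation (norm_nonneg _) (norm_nonneg _) (norm_nonneg _) hC₀ hC₁ ht ?_ ?_ hγ₀ hγ₁⟩
  · refine (h t ht.le v).trans (mul_le_mul_of_nonneg_right ?_ (norm_nonneg _))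
    exact mul_le_of_le_one_right hC₀.le (Real.exp_le_one_iff.2 (by nlinarith))
  · rcases le_total t 1 with h1 | h1
    · refine (D.norm_T_le_norm_G ht v).trans (mul_le_mul_of_nonneg_right
        (div_le_div_of_nonneg_right ?_ ht.le) (norm_nonneg _))
      have h2 := D.exp_mul_le_exp_mul h1
      rw [mul_one] at h2
      exact h2.trans (le_add_of_nonneg_right (by positivity))
    -- Smoothing is used over one unit of time only, since its constant grows like `e^{Kt}`;
    -- exponential decay handles the rest.
    · have e : D.T t v = D.T (t - 1) (D.T 1 v) := by
        rw [← ContinuousLinearMap.comp_apply, ← D.T_add (by linarith) zero_le_one, sub_add_cancel]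
      rw [e]
      have h2 := D.norm_T_le_norm_G one_pos v
      rw [mul_one, div_one] at h2
      have h3 : t * Real.exp (-(δ / 2) * (t - 1)) ≤ Real.exp (δ / 2) * (2 / δ) := by
        have h4 : δ / 2 * t ≤ Real.exp (δ / 2 * t) := by
          linarith [Real.add_one_le_exp (δ / 2 * t)]
        have h5 : Real.exp (-(δ / 2) * (t - 1)) * Real.exp (δ / 2 * t) = Real.exp (δ / 2) := by
          rw [← Real.exp_add]; congr 1; ring
        rw [← h5, mul_assoc, mul_comm t]
        refine mul_le_mul_of_nonneg_left ?_ (Real.exp_pos _).le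
        rw [mul_div_assoc', le_div_iff₀ hδ]
        linarith
      refine (h (t - 1) (by linarith) _).trans ?_
      rw [div_mul_eq_mul_div, le_div_iff₀ ht]
      calc C₀ * Real.exp (-(δ / 2) * (t - 1)) * ‖D.T 1 v‖ * t
          = C₀ * (t * Real.exp (-(δ / 2) * (t - 1))) * ‖D.T 1 v‖ := by ring
        _ ≤ C₀ * (Real.exp (δ / 2) * (2 / δ)) * (Real.exp D.K * ‖D.G v‖) := by
            gcongr
        _ ≤ C₁ * ‖D.G v‖ := by
            rw [← mul_assoc]
            refine mul_le_mul_of_nonneg_right ?_ (norm_nonneg _)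
            have := Real.exp_pos D.K
            simp only [C₁]
            linarith

end DissipativeSystem

/-! ### Fourier coefficients of smooth functions -/

/-- The unnormalised Fourier coefficient `∫ f(x) exp (-i m·x) dx` of a real function. -/
def coef (f : Torus → ℝ) (m : Freq) : ℂ := ∫ x, (f x : ℂ) * expMode (-m) x

lemma norm_expMode (k : Freq) (x : Torus) : ‖expMode k x‖ = 1 := by
  simp only [expMode, ContinuousMap.coe_mk, norm_prod, fourier_apply, Circle.norm_coe,
    Finset.prod_const_one]

lemma coef_neg (f : Torus → ℝ) (m : Freq) : coef f (-m) = conj (coef f m) := by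
  rw [coef, coef, ← integral_conj]
  refine integral_congr_ae (Eventually.of_forall fun x => ?_)
  simp only [map_mul, Complex.conj_ofReal, expMode_neg, Complex.conj_conj]

lemma integrable_of_continuous {f : Torus → ℂ} (hf : Continuous f) : Integrable f :=
  hf.integrable_of_hasCompactSupport (HasCompactSupport.of_compactSpace f)

lemma proj_surjective : Function.Surjective proj := isQuotientMap_proj.surjective

lemma proj_add_smul (x : Fin 2 → ℝ) (j : Fin 2) (s : ℝ) :
    proj (x + s • Pi.single j 1) = proj x + Pi.single j (s : AddCircle (2 * Real.pi)) := by
  funext i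
  by_cases hi : i = j
  · subst hi; simp [proj]
  · simp [proj, hi]

lemma IsSmooth.hasDerivAt {f : Torus → ℝ} (hf : IsSmooth f) (j : Fin 2) (x : Torus) :
    HasDerivAt (fun s : ℝ => f (x + Pi.single j (s : AddCircle (2 * Real.pi))))
      (pderiv j f x) 0 := by
  obtain ⟨y, rfl⟩ := proj_surjective x
  have hd : DifferentiableAt ℝ (fun y => f (proj y)) y :=
    (ContDiff.differentiable hf (by simp)).differentiableAt
  have h := (hd.lineDifferentiableAt (v := Pi.single j 1)).hasLineDerivAt
  unfold HasLineDerivAt at h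
  simp only [proj_add_smul] at h
  exact h.differentiableAt.hasDerivAt

lemma IsSmooth.pderiv {f : Torus → ℝ} (hf : IsSmooth f) (j : Fin 2) : IsSmooth (pderiv j f) := by
  have h : (fun x => QG.pderiv j f (proj x)) =
      fun x => fderiv ℝ (fun y => f (proj y)) x (Pi.single j 1) := by
    funext x
    have hd : DifferentiableAt ℝ (fun y => f (proj y)) x :=
      (ContDiff.differentiable hf (by simp)).differentiableAt
    have h1 := hd.hasFDerivAt.hasLineDerivAt (Pi.single j 1)
    unfold HasLineDerivAt at h1
    simp only [proj_add_smul] at h1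
    exact (hf.hasDerivAt j (proj x)).unique h1
  unfold IsSmooth
  rw [h]
  exact (ContDiff.fderiv_right hf (by simp)).clm_apply contDiff_const

lemma expMode_add_single (k : Freq) (x : Torus) (j : Fin 2) (s : ℝ) :
    expMode k (x + Pi.single j (s : AddCircle (2 * Real.pi))) =
      expMode k x * Complex.exp (Complex.I * k j * s) := by
  have h : fourier (k j) (s : AddCircle (2 * Real.pi)) = Complex.exp (Complex.I * k j * s) := by
    rw [fourier_coe_apply]
    congr 1
    have : (Real.pi : ℂ) ≠ 0 := by exact_mod_cast Real.pi_ne_zero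
    push_cast
    field_simp
  rw [← h]
  have hadd : ∀ (n : ℤ) (x y : AddCircle (2 * Real.pi)),
      (fourier n (x + y) : ℂ) = fourier n x * fourier n y := fun n x y => by
    simp [fourier_apply, smul_add, AddCircle.toCircle_add]
  have h1 : ∏ i, (fourier (k i) ((Pi.single j (s : AddCircle (2 * Real.pi)) : Torus) i) : ℂ) =
      fourier (k j) (s : AddCircle (2 * Real.pi)) := by
    rw [Finset.prod_eq_single j, Pi.single_eq_same]
    · intro i _ hi
      rw [Pi.single_eq_of_ne hi, fourier_eval_zero]
    · simp
  rw [← h1]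
  simp only [expMode, ContinuousMap.coe_mk, Pi.add_apply, hadd, Finset.prod_mul_distrib]

/-- The integral over the torus of a partial derivative vanishes. -/
lemma integral_deriv_eq_zero {g g' : Torus → ℂ} (hg : Continuous g) (hg' : Continuous g')
    (j : Fin 2)
    (h : ∀ x, HasDerivAt (fun s : ℝ => g (x + Pi.single j (s : AddCircle (2 * Real.pi))))
      (g' x) 0) : ∫ x, g' x = 0 := by
  have hs : ∀ (x : Torus) (s : ℝ),
      HasDerivAt (fun s : ℝ => g (x + Pi.single j (s : AddCircle (2 * Real.pi))))
        (g' (x + Pi.single j (s : AddCircle (2 * Real.pi)))) s := by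
    intro x s
    have h1 := h (x + Pi.single j (s : AddCircle (2 * Real.pi)))
    have h2 : HasDerivAt (fun r : ℝ => r - s) 1 s := (hasDerivAt_id s).sub_const s
    have h3 := h1.scomp_of_eq s h2 (sub_self s).symm
    rw [one_smul] at h3
    refine h3.congr_of_eventuallyEq (Eventually.of_forall fun r => ?_)
    simp only [Function.comp_apply]
    rw [add_assoc, ← Pi.single_add, ← AddCircle.coe_add, add_sub_cancel]
  obtain ⟨C, hC⟩ := isCompact_univ.exists_bound_of_continuousOn (f := g') hg'.continuousOn
  have hcont : ∀ s : ℝ, Continuous fun x : Torus => x + Pi.single j (s : AddCircle (2 * Real.pi)) :=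
    fun s => continuous_id.add continuous_const
  let φ : ℝ → Torus → ℂ := fun s x => g (x + Pi.single j (s : AddCircle (2 * Real.pi)))
  let φ' : ℝ → Torus → ℂ := fun s x => g' (x + Pi.single j (s : AddCircle (2 * Real.pi)))
  -- Translation invariance makes the integral of `g (x + s e_j)` constant in `s`; its derivative at
  -- `0`, taken under the integral, is the integral of `g'`.
  have h1 := (hasDerivAt_integral_of_dominated_loc_of_deriv_le (μ := (volume : Measure Torus))
    (F := φ) (F' := φ') (x₀ := (0 : ℝ))
    (s := Set.univ) (bound := fun _ => C) univ_mem
    (Eventually.of_forall fun s => (hg.comp (hcont s)).aestronglyMeasurable)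
    (integrable_of_continuous (hg.comp (hcont 0))) (hg'.comp (hcont 0)).aestronglyMeasurable
    (Eventually.of_forall fun x s _ => hC _ (Set.mem_univ _)) (integrable_const C)
    (Eventually.of_forall fun x s _ => hs x s)).2
  have h2 : ∀ s : ℝ, ∫ x : Torus, g (x + Pi.single j (s : AddCircle (2 * Real.pi))) = ∫ x, g x :=
    fun s => integral_add_right_eq_self g _
  simp only [φ, φ', h2] at h1
  have h3 := h1.unique (hasDerivAt_const (0 : ℝ) (∫ x, g x))
  simpa using h3

lemma continuous_mul_expMode {f : Torus → ℝ} (hf : Continuous f) (m : Freq) :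
    Continuous fun x => (f x : ℂ) * expMode m x :=
  (Complex.continuous_ofReal.comp hf).mul (expMode m).continuous

/-- Integration by parts: the integral of `∂_j (f e^{-im·x})` vanishes. -/
lemma coef_pderiv {f : Torus → ℝ} (hf : IsSmooth f) (j : Fin 2) (m : Freq) :
    coef (pderiv j f) m = Complex.I * m j * coef f m := by
  have hc1 := continuous_mul_expMode (hf.continuous_pderiv j) (-m)
  have hc2 := continuous_mul_expMode hf.continuous (-m)
  have h := integral_deriv_eq_zero hc2
    (g' := fun x => (pderiv j f x : ℂ) * expMode (-m) x +
      (-(Complex.I * m j)) * ((f x : ℂ) * expMode (-m) x))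
    (hc1.add (continuous_const.mul hc2)) j fun x => by
      have h1 := (hf.hasDerivAt j x).ofReal_comp
      have h2 : HasDerivAt (fun s : ℝ => expMode (-m) x * Complex.exp (Complex.I * (-m) j * s))
          (expMode (-m) x * (-(Complex.I * m j))) 0 := by
        have := ((((hasDerivAt_id ((0 : ℝ) : ℂ)).const_mul
          (Complex.I * ((-m) j : ℤ))).cexp).comp_ofReal).const_mul (expMode (-m) x)
        simpa using this
      simp only [← expMode_add_single] at h2
      refine (h1.mul h2).congr_deriv ?_
      simp
      ring
  rw [integral_add (integrable_of_continuous hc1)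
    ((integrable_of_continuous hc2).const_mul _), integral_const_mul] at h
  rw [coef, coef]
  linear_combination h

lemma exists_norm_coef_le (f : Torus → ℝ) : ∃ C, ∀ m, ‖coef f m‖ ≤ C := by
  refine ⟨∫ x, ‖(f x : ℂ)‖, fun m => (norm_integral_le_integral_norm _).trans_eq ?_⟩
  simp only [norm_mul, norm_expMode, mul_one]

lemma exists_pow_mul_norm_coef_le (j : Fin 2) (p : ℕ) {f : Torus → ℝ} (hf : IsSmooth f) :
    ∃ C, ∀ m : Freq, |(m j : ℝ)| ^ p * ‖coef f m‖ ≤ C := by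
  induction p generalizing f with
  | zero => simpa using exists_norm_coef_le f
  | succ p ih =>
    obtain ⟨C, hC⟩ := ih (hf.pderiv j)
    refine ⟨C, fun m => le_trans (le_of_eq ?_) (hC m)⟩
    rw [coef_pderiv hf, norm_mul, norm_mul, Complex.norm_I, one_mul, Complex.norm_intCast]
    ring

lemma freqNorm_nonneg (k : Freq) : 0 ≤ freqNorm k := Real.sqrt_nonneg _

lemma freqNorm_le (k : Freq) : freqNorm k ≤ 2 * ‖k‖ := by
  have h : ∀ j, |(k j : ℝ)| ≤ ‖k‖ := fun j => by
    have := norm_le_pi_norm k j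
    rwa [Int.norm_eq_abs] at this
  rw [freqNorm]
  refine Real.sqrt_le_iff.2 ⟨by positivity, ?_⟩
  nlinarith [sq_abs (k 0 : ℝ), sq_abs (k 1 : ℝ), pow_le_pow_left₀ (abs_nonneg _) (h 0) 2,
    pow_le_pow_left₀ (abs_nonneg _) (h 1) 2, sq_nonneg ‖k‖]

lemma exists_norm_pow_mul_norm_coef_le (p : ℕ) {f : Torus → ℝ} (hf : IsSmooth f) :
    ∃ C, ∀ m : Freq, ‖m‖ ^ p * ‖coef f m‖ ≤ C := by
  obtain ⟨C₀, h₀⟩ := exists_pow_mul_norm_coef_le 0 p hf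
  obtain ⟨C₁, h₁⟩ := exists_pow_mul_norm_coef_le 1 p hf
  refine ⟨max C₀ C₁, fun m => ?_⟩
  obtain ⟨j, hj⟩ : ∃ j, ‖m‖ = |(m j : ℝ)| := by
    obtain ⟨j, -, hj⟩ := Finset.exists_mem_eq_sup Finset.univ Finset.univ_nonempty
      fun j => ‖m j‖₊
    refine ⟨j, ?_⟩
    rw [Pi.norm_def, hj, coe_nnnorm, Int.norm_eq_abs]
  rw [hj]
  fin_cases j
  · exact (h₀ m).trans (le_max_left _ _)
  · exact (h₁ m).trans (le_max_right _ _)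

/-- Decay of order `p + 3` leaves `‖m‖⁻³`, summable over the two-dimensional lattice. The frequency
`0` is discarded because `1 + freqNorm m ≤ 3 * ‖m‖` needs `‖m‖ ≥ 1`. -/
lemma summable_coef_mul_pow {f : Torus → ℝ} (hf : IsSmooth f) (p : ℕ) :
    Summable fun m : Freq => ‖coef f m‖ * (1 + freqNorm m) ^ p := by
  obtain ⟨C, hC⟩ := exists_norm_pow_mul_norm_coef_le (p + 3) hf
  refine Summable.of_norm_bounded_eventually
    ((EisensteinSeries.summable_one_div_norm_rpow (k := 3) (by norm_num)).mul_left (3 ^ p * C)) ?_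
  have hfin : ∀ᶠ m : Freq in cofinite, m ≠ 0 := (Set.finite_singleton (0 : Freq)).compl_mem_cofinite
  filter_upwards [hfin] with m hm
  have h1 : 1 ≤ ‖m‖ := by
    obtain ⟨j, hj⟩ := Function.ne_iff.mp hm
    refine le_trans ?_ (norm_le_pi_norm m j)
    rw [Int.norm_eq_abs]
    exact_mod_cast Int.one_le_abs hj
  have h0 : 0 < ‖m‖ := by linarith
  rw [Real.norm_of_nonneg (mul_nonneg (norm_nonneg _) (pow_nonneg
    (by linarith [freqNorm_nonneg m]) _)), Real.rpow_neg h0.le, ← div_eq_mul_inv,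
    le_div_iff₀ (by positivity)]
  have h2 : (1 + freqNorm m) ^ p ≤ 3 ^ p * ‖m‖ ^ p := by
    rw [← mul_pow]
    exact pow_le_pow_left₀ (by linarith [freqNorm_nonneg m]) (by linarith [freqNorm_le m]) _
  have h3 : ‖m‖ ^ (3 : ℝ) = ‖m‖ ^ 3 := by exact_mod_cast Real.rpow_natCast ‖m‖ 3
  rw [h3]
  calc ‖coef f m‖ * (1 + freqNorm m) ^ p * ‖m‖ ^ 3
      ≤ ‖coef f m‖ * (3 ^ p * ‖m‖ ^ p) * ‖m‖ ^ 3 := by gcongr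
    _ = 3 ^ p * (‖m‖ ^ (p + 3) * ‖coef f m‖) := by ring
    _ ≤ 3 ^ p * C := mul_le_mul_of_nonneg_left (hC m) (by positivity)

/-! ### Matrix entries in the Fourier basis -/

lemma coeFn_expL2 (k : Freq) :
    expL2 k =ᵐ[volume] fun x => ((2 * Real.pi : ℝ) : ℂ)⁻¹ * expMode k x := by
  rw [expL2]
  filter_upwards [Lp.coeFn_smul ((2 * Real.pi : ℝ) : ℂ)⁻¹
    (ContinuousMap.toLp (E := ℂ) 2 (volume : Measure Torus) ℂ (expMode k)),
    ContinuousMap.coeFn_toLp (p := 2) (𝕜 := ℂ) (volume : Measure Torus) (expMode k)] with x h1 h2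
  rw [h1, Pi.smul_apply, h2, smul_eq_mul]

lemma fourierBasis_apply (k : Freq) : fourierBasis k = expL2 k := by
  rw [fourierBasis, HilbertBasis.coe_mk]

lemma repr_eq_inner (v : L2) (k : Freq) : fourierBasis.repr v k = inner ℂ (expL2 k) v := by
  rw [fourierBasis.repr_apply_apply, fourierBasis_apply]

lemma inner_expL2 (k : Freq) (v : L2) :
    inner ℂ (expL2 k) v = ((2 * Real.pi : ℝ) : ℂ)⁻¹ * ∫ x, expMode (-k) x * v x := by
  rw [L2.inner_def, ← integral_const_mul]
  refine integral_congr_ae ?_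
  filter_upwards [coeFn_expL2 k] with x hx
  rw [hx, RCLike.inner_apply, map_mul, map_inv₀, Complex.conj_ofReal, expMode_neg]
  ring

lemma mem_L2mf_iff {v : L2} : v ∈ L2mf ↔ inner ℂ (expL2 0) v = 0 := by
  have hpi : ((2 * Real.pi : ℝ) : ℂ)⁻¹ ≠ 0 := inv_ne_zero (by exact_mod_cast Real.two_pi_pos.ne')
  have h : ∀ x, expMode (-0) x = 1 := fun x => by simp [expMode]
  rw [inner_expL2]
  simp only [h, one_mul, mul_eq_zero, hpi, false_or]
  rfl

lemma coeFn_mulOp (a : Torus → ℝ) (ha : Continuous a) (v : L2) :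
    mulOp a ha v =ᵐ[volume] fun x => (a x : ℂ) * v x := by
  simp only [mulOp, LinearMap.coe_mk, AddHom.coe_mk]
  exact MemLp.coeFn_toLp _

lemma inner_mulOp (a : Torus → ℝ) (ha : Continuous a) (k l : Freq) :
    inner ℂ (expL2 k) (mulOp a ha (expL2 l)) =
      ((2 * Real.pi : ℝ) : ℂ)⁻¹ ^ 2 * coef a (k - l) := by
  rw [inner_expL2, sq, mul_assoc, coef]
  congr 1
  rw [← integral_const_mul]
  refine integral_congr_ae ?_
  filter_upwards [coeFn_mulOp a ha (expL2 l), coeFn_expL2 l] with x h1 h2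
  rw [h1, h2, neg_sub, sub_eq_add_neg, expMode_add]
  ring

lemma inner_toL2 (f : Torus → ℝ) (hf : Continuous f) (k : Freq) :
    inner ℂ (expL2 k) (toL2 f hf) = ((2 * Real.pi : ℝ) : ℂ)⁻¹ * coef f k := by
  rw [inner_expL2, coef]
  congr 1
  refine integral_congr_ae ?_
  filter_upwards [ContinuousMap.coeFn_toLp (p := 2) (𝕜 := ℂ) (volume : Measure Torus)
    (⟨fun x => (f x : ℂ), Complex.continuous_ofReal.comp hf⟩ : C(Torus, ℂ))] with x h1
  rw [toL2, h1, mul_comm]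
  rfl

lemma exists_norm_mulOp_le (a : Torus → ℝ) (ha : Continuous a) :
    ∃ C, ∀ v, ‖mulOp a ha v‖ ≤ C * ‖v‖ := by
  obtain ⟨C, hC⟩ := isCompact_univ.exists_bound_of_continuousOn (f := a) ha.continuousOn
  refine ⟨C, fun v => Lp.norm_le_mul_norm_of_ae_le_mul ?_⟩
  filter_upwards [coeFn_mulOp a ha v] with x hx
  rw [hx, norm_mul, Complex.norm_real]
  exact mul_le_mul_of_nonneg_right (hC x (Set.mem_univ x)) (norm_nonneg _)

/-! ### Energy estimates for infinite matrices -/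

/-- The first bound is the commutator gain: a difference of `n`-th powers is one order better than
the powers themselves, which compensates the factor `y` of a first order matrix. The losses are
polynomial in `d`, to be absorbed by the decay of the kernel. -/
lemma zpow_bounds {x y d : ℝ} (hx : 1 ≤ x) (hy : 1 ≤ y) (hd : |x - y| ≤ d) {n : ℤ} (h1 : -2 ≤ n)
    (h2 : n ≤ 2) :
    |x ^ n - y ^ n| * y ≤ 2 * (1 + d) ^ 3 * x ^ n ∧ x ^ n ≤ (1 + d) ^ 2 * y ^ n := by
  have hd0 : 0 ≤ d := (abs_nonneg _).trans hd
  have hx0 : 0 < x := by linarith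
  have hy0 : 0 < y := by linarith
  obtain ⟨hl, hr⟩ := abs_le.1 hd
  have hyx : y ≤ (1 + d) * x := by nlinarith
  have hxy : x ≤ (1 + d) * y := by nlinarith
  have hp : 1 ≤ 1 + d := by linarith
  have hp2 : 1 ≤ (1 + d) ^ 2 := one_le_pow₀ hp
  have hp3 : 1 ≤ (1 + d) ^ 3 := one_le_pow₀ hp
  have hdp : d * (1 + d) ≤ 2 * (1 + d) ^ 3 := by nlinarith [pow_nonneg hd0 2, pow_nonneg hd0 3]
  have hdp2 : d * (2 + d) ≤ 2 * (1 + d) ^ 3 := by nlinarith [pow_nonneg hd0 2, pow_nonneg hd0 3]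
  have hdp3 : d * (2 + d) * (1 + d) ≤ 2 * (1 + d) ^ 3 := by
    nlinarith [pow_nonneg hd0 2, pow_nonneg hd0 3]
  have hsum : x + y ≤ (2 + d) * x := by linarith
  have hsum' : x + y ≤ (2 + d) * y := by linarith
  interval_cases n
  · have e1 : x ^ (-2 : ℤ) = (x ^ 2)⁻¹ := by rw [zpow_neg]; norm_cast
    have e2 : y ^ (-2 : ℤ) = (y ^ 2)⁻¹ := by rw [zpow_neg]; norm_cast
    rw [e1, e2]
    constructor
    · have e : (x ^ 2)⁻¹ - (y ^ 2)⁻¹ = -((x - y) * (x + y)) / (x ^ 2 * y ^ 2) := by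
        field_simp; ring
      rw [e, abs_div, abs_neg, abs_mul, abs_of_pos (show 0 < x + y by linarith),
        abs_of_pos (show 0 < x ^ 2 * y ^ 2 by positivity), div_mul_eq_mul_div, ← div_eq_mul_inv,
        div_le_div_iff₀ (by positivity) (by positivity)]
      have : |x - y| * (x + y) ≤ d * ((2 + d) * y) :=
        mul_le_mul hd hsum' (by linarith) hd0
      calc |x - y| * (x + y) * y * x ^ 2 ≤ d * ((2 + d) * y) * y * x ^ 2 := by gcongr
        _ = d * (2 + d) * (x ^ 2 * y ^ 2) := by ring
        _ ≤ _ := by gcongr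
    · rw [← div_eq_mul_inv, inv_eq_one_div, div_le_div_iff₀ (by positivity) (by positivity), one_mul,
        ← mul_pow]
      gcongr
  · simp only [Int.reduceNeg, zpow_neg, zpow_one]
    constructor
    · have e : x⁻¹ - y⁻¹ = -(x - y) / (x * y) := by field_simp; ring
      rw [e, abs_div, abs_neg, abs_of_pos (show 0 < x * y by positivity), div_mul_eq_mul_div,
        ← div_eq_mul_inv, div_le_div_iff₀ (by positivity) (by positivity)]
      calc |x - y| * y * x = |x - y| * (x * y) := by ring
        _ ≤ d * (x * y) := by gcongr
        _ ≤ _ := by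
          gcongr
          nlinarith
    · rw [← div_eq_mul_inv, inv_eq_one_div, div_le_div_iff₀ (by positivity) (by positivity), one_mul]
      nlinarith
  · simp only [zpow_zero, sub_self, abs_zero, zero_mul, mul_one]
    constructor <;> linarith
  · simp only [zpow_one]
    constructor
    · calc |x - y| * y ≤ d * ((1 + d) * x) := mul_le_mul hd hyx hy0.le hd0
        _ = d * (1 + d) * x := by ring
        _ ≤ _ := by gcongr
    · nlinarith
  · have e1 : x ^ (2 : ℤ) = x ^ 2 := by norm_cast
    have e2 : y ^ (2 : ℤ) = y ^ 2 := by norm_cast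
    rw [e1, e2]
    constructor
    · have e : x ^ 2 - y ^ 2 = (x - y) * (x + y) := by ring
      rw [e, abs_mul, abs_of_pos (show 0 < x + y by linarith)]
      calc |x - y| * (x + y) * y ≤ d * ((2 + d) * x) * ((1 + d) * x) := by gcongr
        _ = d * (2 + d) * (1 + d) * x ^ 2 := by ring
        _ ≤ _ := by gcongr
    · rw [← mul_pow]
      gcongr

section MatrixEnergy

variable {ι : Type*} {w : ι → ℝ} {κ d : ι → ι → ℝ} {S : ℝ}

/-- Schur's test with weights. -/
lemma sum_sum_kernel_le (hw : ∀ k, 1 ≤ w k) (hd : ∀ k l, |w k - w l| ≤ d k l)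
    (hκ : ∀ k l, 0 ≤ κ k l) {n : ℤ} (h1 : -2 ≤ n) (h2 : n ≤ 2) (F : Finset ι)
    (hrow : ∀ k, ∑ l ∈ F, κ k l * (1 + d k l) ^ 5 ≤ S)
    (hcol : ∀ l, ∑ k ∈ F, κ k l * (1 + d k l) ^ 5 ≤ S) (u : ι → ℂ) :
    ∑ k ∈ F, ∑ l ∈ F, κ k l * (1 + d k l) ^ 3 * (w k ^ n * (‖u k‖ * ‖u l‖)) ≤
      S * ∑ k ∈ F, w k ^ n * ‖u k‖ ^ 2 := by
  have hwn : ∀ k, 0 ≤ w k ^ n := fun k => zpow_nonneg (zero_le_one.trans (hw k)) n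
  -- After `2|u k||u l| ≤ |u k|² + |u l|²`, moving the weight from `k` to `l` costs `(1 + d)²`;
  -- hence the exponent `5 = 3 + 2`.
  have hterm : ∀ k l, κ k l * (1 + d k l) ^ 3 * (w k ^ n * (‖u k‖ * ‖u l‖)) ≤
      2⁻¹ * (κ k l * (1 + d k l) ^ 5 * (w k ^ n * ‖u k‖ ^ 2)) +
      2⁻¹ * (κ k l * (1 + d k l) ^ 5 * (w l ^ n * ‖u l‖ ^ 2)) := by
    intro k l
    have hd0 : 0 ≤ d k l := (abs_nonneg _).trans (hd k l)
    have e1 : w k ^ n * ‖u l‖ ^ 2 ≤ (1 + d k l) ^ 2 * (w l ^ n * ‖u l‖ ^ 2) := by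
      rw [← mul_assoc]
      exact mul_le_mul_of_nonneg_right (zpow_bounds (hw k) (hw l) (hd k l) h1 h2).2 (sq_nonneg _)
    have e2 : w k ^ n * ‖u k‖ ^ 2 ≤ (1 + d k l) ^ 2 * (w k ^ n * ‖u k‖ ^ 2) :=
      le_mul_of_one_le_left (mul_nonneg (hwn k) (sq_nonneg _)) (one_le_pow₀ (by linarith))
    have e3 : w k ^ n * (‖u k‖ * ‖u l‖) ≤
        2⁻¹ * (w k ^ n * ‖u k‖ ^ 2) + 2⁻¹ * (w k ^ n * ‖u l‖ ^ 2) := by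
      nlinarith [mul_nonneg (hwn k) (sq_nonneg (‖u k‖ - ‖u l‖))]
    have e4 : 0 ≤ κ k l * (1 + d k l) ^ 3 := mul_nonneg (hκ k l) (by positivity)
    calc κ k l * (1 + d k l) ^ 3 * (w k ^ n * (‖u k‖ * ‖u l‖))
        ≤ κ k l * (1 + d k l) ^ 3 * (2⁻¹ * ((1 + d k l) ^ 2 * (w k ^ n * ‖u k‖ ^ 2)) +
            2⁻¹ * ((1 + d k l) ^ 2 * (w l ^ n * ‖u l‖ ^ 2))) :=
          mul_le_mul_of_nonneg_left (by linarith) e4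
      _ = _ := by ring
  refine (Finset.sum_le_sum fun k _ => Finset.sum_le_sum fun l _ => hterm k l).trans ?_
  simp only [Finset.sum_add_distrib, ← Finset.mul_sum]
  have r1 : ∑ k ∈ F, ∑ l ∈ F, κ k l * (1 + d k l) ^ 5 * (w k ^ n * ‖u k‖ ^ 2) ≤
      S * ∑ k ∈ F, w k ^ n * ‖u k‖ ^ 2 := by
    rw [Finset.mul_sum]
    refine Finset.sum_le_sum fun k _ => ?_
    rw [← Finset.sum_mul]
    exact mul_le_mul_of_nonneg_right (hrow k) (mul_nonneg (hwn k) (sq_nonneg _))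
  have r2 : ∑ k ∈ F, ∑ l ∈ F, κ k l * (1 + d k l) ^ 5 * (w l ^ n * ‖u l‖ ^ 2) ≤
      S * ∑ k ∈ F, w k ^ n * ‖u k‖ ^ 2 := by
    rw [Finset.sum_comm, Finset.mul_sum]
    refine Finset.sum_le_sum fun l _ => ?_
    rw [← Finset.sum_mul]
    exact mul_le_mul_of_nonneg_right (hcol l) (mul_nonneg (hwn l) (sq_nonneg _))
  linarith

/-- The contribution of a skew-Hermitian first order matrix to a weighted energy is of order
zero. -/
lemma re_sum_skew_le (hw : ∀ k, 1 ≤ w k) (hd : ∀ k l, |w k - w l| ≤ d k l)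
    (hκ : ∀ k l, 0 ≤ κ k l) {n : ℤ} (h1 : -2 ≤ n) (h2 : n ≤ 2) (F : Finset ι)
    (hrow : ∀ k, ∑ l ∈ F, κ k l * (1 + d k l) ^ 5 ≤ S)
    (hcol : ∀ l, ∑ k ∈ F, κ k l * (1 + d k l) ^ 5 ≤ S) {a : ι → ι → ℂ}
    (ha : ∀ k l, ‖a k l‖ ≤ κ k l * w l) (hskew : ∀ k l, conj (a l k) = -a k l) (u : ι → ℂ) :
    (∑ k ∈ F, ∑ l ∈ F, (w k ^ n : ℝ) * (conj (u k) * (a k l * u l))).re ≤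
      S * ∑ k ∈ F, w k ^ n * ‖u k‖ ^ 2 := by
  set z := ∑ k ∈ F, ∑ l ∈ F, ((w k ^ n : ℝ) : ℂ) * (conj (u k) * (a k l * u l)) with hz
  -- Skewness and exchanging `k` with `l` move the weight to the other index, so `2 Re z` only
  -- involves the differences `w k ^ n - w l ^ n`.
  have hconj : conj z = -∑ k ∈ F, ∑ l ∈ F, ((w l ^ n : ℝ) : ℂ) * (conj (u k) * (a k l * u l)) := by
    rw [hz, map_sum, Finset.sum_congr rfl fun k _ => map_sum _ _ _, Finset.sum_comm,
      ← Finset.sum_neg_distrib]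
    refine Finset.sum_congr rfl fun k _ => ?_
    rw [← Finset.sum_neg_distrib]
    refine Finset.sum_congr rfl fun l _ => ?_
    rw [map_mul, map_mul, map_mul, Complex.conj_ofReal, Complex.conj_conj, hskew]
    ring
  have hre : z.re = 2⁻¹ * (z + conj z).re := by
    rw [Complex.add_re, Complex.conj_re]; ring
  have hsum : z + conj z = ∑ k ∈ F, ∑ l ∈ F,
      ((w k ^ n - w l ^ n : ℝ) : ℂ) * (conj (u k) * (a k l * u l)) := by
    rw [hconj, hz, ← sub_eq_add_neg, ← Finset.sum_sub_distrib]
    refine Finset.sum_congr rfl fun k _ => ?_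
    rw [← Finset.sum_sub_distrib]
    refine Finset.sum_congr rfl fun l _ => ?_
    push_cast
    ring
  have hbd : ‖z + conj z‖ ≤
      2 * ∑ k ∈ F, ∑ l ∈ F, κ k l * (1 + d k l) ^ 3 * (w k ^ n * (‖u k‖ * ‖u l‖)) := by
    rw [hsum, Finset.mul_sum]
    refine (norm_sum_le _ _).trans (Finset.sum_le_sum fun k _ => ?_)
    rw [Finset.mul_sum]
    refine (norm_sum_le _ _).trans (Finset.sum_le_sum fun l _ => ?_)
    rw [norm_mul, norm_mul, norm_mul, RCLike.norm_conj, Complex.norm_real, Real.norm_eq_abs]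
    have e1 := (zpow_bounds (hw k) (hw l) (hd k l) h1 h2).1
    calc |w k ^ n - w l ^ n| * (‖u k‖ * (‖a k l‖ * ‖u l‖))
        ≤ |w k ^ n - w l ^ n| * (‖u k‖ * (κ k l * w l * ‖u l‖)) := by
          gcongr
          exact ha k l
      _ = κ k l * (|w k ^ n - w l ^ n| * w l) * (‖u k‖ * ‖u l‖) := by ring
      _ ≤ κ k l * (2 * (1 + d k l) ^ 3 * w k ^ n) * (‖u k‖ * ‖u l‖) := by
          gcongr
          exact hκ k l
      _ = _ := by ring
  have h3 := sum_sum_kernel_le hw hd hκ h1 h2 F hrow hcol u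
  have h4 := Complex.re_le_norm (z + conj z)
  rw [hre]
  linarith

lemma re_sum_bounded_le (hw : ∀ k, 1 ≤ w k) (hd : ∀ k l, |w k - w l| ≤ d k l)
    (hκ : ∀ k l, 0 ≤ κ k l) {n : ℤ} (h1 : -2 ≤ n) (h2 : n ≤ 2) (F : Finset ι)
    (hrow : ∀ k, ∑ l ∈ F, κ k l * (1 + d k l) ^ 5 ≤ S)
    (hcol : ∀ l, ∑ k ∈ F, κ k l * (1 + d k l) ^ 5 ≤ S) {β : ι → ι → ℂ}
    (hβ : ∀ k l, ‖β k l‖ ≤ κ k l) (u : ι → ℂ) :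
    (∑ k ∈ F, ∑ l ∈ F, (w k ^ n : ℝ) * (conj (u k) * (β k l * u l))).re ≤
      S * ∑ k ∈ F, w k ^ n * ‖u k‖ ^ 2 := by
  refine (Complex.re_le_norm _).trans (le_trans ?_
    (sum_sum_kernel_le hw hd hκ h1 h2 F hrow hcol u))
  refine (norm_sum_le _ _).trans (Finset.sum_le_sum fun k _ => ?_)
  refine (norm_sum_le _ _).trans (Finset.sum_le_sum fun l _ => ?_)
  have hd0 : 0 ≤ d k l := (abs_nonneg _).trans (hd k l)
  have hwn : 0 ≤ w k ^ n := zpow_nonneg (zero_le_one.trans (hw k)) n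
  rw [norm_mul, norm_mul, norm_mul, RCLike.norm_conj, Complex.norm_real, Real.norm_of_nonneg hwn]
  calc w k ^ n * (‖u k‖ * (‖β k l‖ * ‖u l‖))
      ≤ w k ^ n * (‖u k‖ * (κ k l * (1 + d k l) ^ 3 * ‖u l‖)) := by
        gcongr
        exact (hβ k l).trans (le_mul_of_one_le_right (hκ k l) (one_le_pow₀ (by linarith)))
    _ = _ := by ring

/-- The energy estimate for a perturbation of the diagonal matrix `-w` by a skew-Hermitian first
order matrix and a matrix of order zero. -/
lemma matrix_energy_le (hw : ∀ k, 1 ≤ w k) (hd : ∀ k l, |w k - w l| ≤ d k l)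
    (hκ : ∀ k l, 0 ≤ κ k l) {n : ℤ} (h1 : -2 ≤ n) (h2 : n ≤ 2) (F : Finset ι)
    (hrow : ∀ k, ∑ l ∈ F, κ k l * (1 + d k l) ^ 5 ≤ S)
    (hcol : ∀ l, ∑ k ∈ F, κ k l * (1 + d k l) ^ 5 ≤ S) {a β : ι → ι → ℂ}
    (ha : ∀ k l, ‖a k l‖ ≤ κ k l * w l) (hskew : ∀ k l, conj (a l k) = -a k l)
    (hβ : ∀ k l, ‖β k l‖ ≤ κ k l) (c : ℝ) (u : ι → ℂ) :
    ∑ k ∈ F, w k ^ n *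
        (conj (u k) * (∑ l ∈ F, (a k l + β k l) * u l - (w k + c : ℝ) * u k)).re ≤
      -∑ k ∈ F, w k ^ (n + 1) * ‖u k‖ ^ 2 + (2 * S + |c|) * ∑ k ∈ F, w k ^ n * ‖u k‖ ^ 2 := by
  have e : ∀ k, w k ^ n *
      (conj (u k) * (∑ l ∈ F, (a k l + β k l) * u l - (w k + c : ℝ) * u k)).re =
      (∑ l ∈ F, ((w k ^ n : ℝ) : ℂ) * (conj (u k) * (a k l * u l))).re +
      (∑ l ∈ F, ((w k ^ n : ℝ) : ℂ) * (conj (u k) * (β k l * u l))).re -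
      (w k ^ (n + 1) * ‖u k‖ ^ 2 + c * (w k ^ n * ‖u k‖ ^ 2)) := by
    intro k
    have hu : conj (u k) * ((w k + c : ℝ) * u k) = (((w k + c) * ‖u k‖ ^ 2 : ℝ) : ℂ) := by
      rw [mul_left_comm, ← Complex.normSq_eq_conj_mul_self, Complex.normSq_eq_norm_sq]
      push_cast
      ring
    rw [← Complex.add_re, ← Finset.sum_add_distrib, mul_sub, hu, Complex.sub_re, Complex.ofReal_re,
      mul_sub, ← Complex.re_ofReal_mul, Finset.mul_sum, Finset.mul_sum,
      zpow_add_one₀ (zero_lt_one.trans_le (hw k)).ne']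
    congr 1
    · congr 1
      refine Finset.sum_congr rfl fun l _ => ?_
      ring
    · ring
  rw [Finset.sum_congr rfl fun k _ => e k]
  rw [Finset.sum_sub_distrib, Finset.sum_add_distrib, Finset.sum_add_distrib, ← Complex.re_sum,
    ← Complex.re_sum, ← Finset.mul_sum]
  have r1 := re_sum_skew_le hw hd hκ h1 h2 F hrow hcol ha hskew u
  have r2 := re_sum_bounded_le hw hd hκ h1 h2 F hrow hcol hβ u
  have r3 : 0 ≤ ∑ k ∈ F, w k ^ n * ‖u k‖ ^ 2 := Finset.sum_nonneg fun k _ =>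
    mul_nonneg (zpow_nonneg (zero_le_one.trans (hw k)) n) (sq_nonneg _)
  have r4 := mul_le_mul_of_nonneg_right (neg_le_abs c) r3
  linarith

end MatrixEnergy

/-! ### The linearized operator as a dissipative system -/

lemma repr_fourierMultiplier (m : Freq → ℂ) (v : (fourierMultiplier m).domain) (k : Freq) :
    fourierBasis.repr (fourierMultiplier m v) k = m k * fourierBasis.repr (v : L2) k := by
  change fourierBasis.repr (fourierBasis.repr.symm (multiplierSeq m v)) k = _
  rw [LinearIsometryEquiv.apply_symm_apply]
  rfl

lemma repr_contractionMultiplier (m : Freq → ℂ) (hm : ∀ k, ‖m k‖ ≤ 1) (v : L2) (k : Freq) :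
    fourierBasis.repr (contractionMultiplier m hm v) k = m k * fourierBasis.repr v k :=
  repr_fourierMultiplier m _ k

lemma norm_contractionMultiplier_le (m : Freq → ℂ) (hm : ∀ k, ‖m k‖ ≤ 1) (v : L2) :
    ‖contractionMultiplier m hm v‖ ≤ ‖v‖ := by
  rw [← fourierBasis.repr.norm_map, ← fourierBasis.repr.norm_map v]
  refine lp.norm_mono (by simp) fun k => ?_
  rw [repr_contractionMultiplier, norm_mul]
  exact mul_le_of_le_one_left (norm_nonneg _) (hm k)

lemma repr_riesz (j : Fin 2) (v : L2) (k : Freq) :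
    fourierBasis.repr (riesz j v) k =
      Complex.I * (k j : ℂ) / (freqNorm k : ℂ) * fourierBasis.repr v k :=
  repr_contractionMultiplier _ _ v k

lemma repr_LamInv (v : L2) (k : Freq) :
    fourierBasis.repr (LamInv v) k = (freqNorm k : ℂ)⁻¹ * fourierBasis.repr v k := by
  rw [← Complex.ofReal_inv]
  exact repr_contractionMultiplier _ _ v k

lemma ext_repr {v v' : L2} (h : ∀ k, fourierBasis.repr v k = fourierBasis.repr v' k) : v = v' :=
  fourierBasis.repr.injective (lp.ext (funext h))

lemma repr_expL2 (l k : Freq) : fourierBasis.repr (expL2 l) k = if k = l then 1 else 0 := by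
  rw [repr_eq_inner, orthonormal_iff_ite.1 orthonormal_expL2]

lemma eq_smul_expL2 {v : L2} {l : Freq} {s : Freq → ℂ}
    (h : ∀ k, fourierBasis.repr v k = s k * fourierBasis.repr (expL2 l) k) :
    v = s l • expL2 l := by
  refine ext_repr fun k => ?_
  rw [h, map_smul, lp.coeFn_smul, Pi.smul_apply, smul_eq_mul, repr_expL2]
  split_ifs with hk
  · rw [hk]
  · simp

lemma riesz_expL2 (j : Fin 2) (l : Freq) :
    riesz j (expL2 l) = (Complex.I * (l j : ℂ) / (freqNorm l : ℂ)) • expL2 l :=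
  eq_smul_expL2 (s := fun k => Complex.I * (k j : ℂ) / (freqNorm k : ℂ))
    (repr_riesz j (expL2 l))

lemma LamInv_expL2 (l : Freq) : LamInv (expL2 l) = (freqNorm l : ℂ)⁻¹ • expL2 l :=
  eq_smul_expL2 (s := fun k => (freqNorm k : ℂ)⁻¹) (repr_LamInv (expL2 l))

/-- `riesz` as a bounded operator. -/
def rieszL (j : Fin 2) : L2 →L[ℂ] L2 :=
  (riesz j).mkContinuous 1 fun v => by
    rw [one_mul]
    exact norm_contractionMultiplier_le _ _ v

/-- `LamInv` as a bounded operator. -/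
def LamInvL : L2 →L[ℂ] L2 :=
  LamInv.mkContinuous 1 fun v => by
    rw [one_mul]
    exact norm_contractionMultiplier_le _ _ v

/-- `mulOp` as a bounded operator. -/
def mulOpL (a : Torus → ℝ) (ha : Continuous a) : L2 →L[ℂ] L2 :=
  (mulOp a ha).mkContinuousOfExistsBound (exists_norm_mulOp_le a ha)

lemma isClosed_L2mf : IsClosed (L2mf : Set L2) := by
  have h : (L2mf : Set L2) = {v | inner ℂ (expL2 0) v = 0} := Set.ext fun v => mem_L2mf_iff
  rw [h]
  exact isClosed_eq (by fun_prop) continuous_const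

instance completeSpace_L2mf : CompleteSpace L2mf := isClosed_L2mf.completeSpace_coe

/-- The nonzero frequencies. -/
abbrev NzFreq : Type := {k : Freq // k ≠ 0}

lemma expL2_mem_L2mf {k : Freq} (hk : k ≠ 0) : expL2 k ∈ L2mf :=
  mem_L2mf_iff.2 (orthonormal_expL2.2 hk.symm)

lemma orthonormal_mf :
    Orthonormal ℂ fun k : NzFreq => (⟨expL2 k, expL2_mem_L2mf k.2⟩ : L2mf) := by
  rw [← L2mf.subtypeₗᵢ.orthonormal_comp_iff]
  exact orthonormal_expL2.comp _ Subtype.val_injective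

/-- The Fourier basis of the mean-free functions. -/
def mfBasis : HilbertBasis NzFreq ℂ L2mf :=
  HilbertBasis.mkOfOrthogonalEqBot orthonormal_mf (by
    rw [Submodule.eq_bot_iff]
    intro v hv
    refine Subtype.ext (ext_repr fun k => ?_)
    rw [repr_eq_inner, ZeroMemClass.coe_zero, map_zero, lp.coeFn_zero, Pi.zero_apply]
    by_cases hk : k = 0
    · rw [hk]
      exact mem_L2mf_iff.1 v.2
    · exact (Submodule.mem_orthogonal _ _).1 hv _ (Submodule.subset_span ⟨⟨k, hk⟩, rfl⟩))

lemma mfBasis_coe (k : NzFreq) : ((mfBasis k : L2mf) : L2) = expL2 k := by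
  rw [mfBasis, HilbertBasis.coe_mkOfOrthogonalEqBot]

lemma inner_mfBasis (k : NzFreq) (v : L2mf) :
    inner ℂ (mfBasis k) v = fourierBasis.repr (v : L2) k := by
  rw [repr_eq_inner, ← mfBasis_coe, Submodule.coe_inner]

lemma one_le_freqNorm {k : Freq} (hk : k ≠ 0) : 1 ≤ freqNorm k := by
  obtain ⟨j, hj⟩ := Function.ne_iff.mp hk
  have h1 : (1 : ℝ) ≤ |(k j : ℝ)| := by exact_mod_cast Int.one_le_abs hj
  exact h1.trans (abs_le_freqNorm k j)

lemma abs_freqNorm_sub_le (k l : Freq) : |freqNorm k - freqNorm l| ≤ freqNorm (k - l) := by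
  have h : ∀ k : Freq, freqNorm k = ‖((k 0 : ℝ) + (k 1 : ℝ) * Complex.I : ℂ)‖ := fun k =>
    (Complex.norm_add_mul_I _ _).symm
  rw [h, h, h]
  refine (abs_norm_sub_norm_le _ _).trans_eq ?_
  congr 1
  simp only [Pi.sub_apply]
  push_cast
  ring

lemma finite_freqNorm_le (N : ℝ) : {k : NzFreq | freqNorm k ≤ N}.Finite := by
  have h : {k : Freq | freqNorm k ≤ N}.Finite := by
    refine (Set.finite_Icc (fun _ => -⌈N⌉ : Freq) (fun _ => ⌈N⌉)).subset fun k hk => ?_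
    have h1 : ∀ j, |k j| ≤ ⌈N⌉ := fun j => by
      have := ((abs_le_freqNorm k j).trans hk).trans (Int.le_ceil N)
      exact_mod_cast this
    exact ⟨fun j => (abs_le.1 (h1 j)).1, fun j => (abs_le.1 (h1 j)).2⟩
  exact h.preimage Subtype.val_injective.injOn

lemma LamInv_mem_L2mf {v : L2} (hv : v ∈ L2mf) : LamInv v ∈ L2mf := by
  rw [mem_L2mf_iff, ← repr_eq_inner] at *
  rw [repr_LamInv, hv, mul_zero]

/-- `Λ⁻¹` on mean-free functions. -/
def LamInvMf : L2mf →L[ℂ] L2mf :=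
  (LamInvL ∘L L2mf.subtypeL).codRestrict L2mf fun v => LamInv_mem_L2mf v.2

/-! ### Matrix of the linearized operator in the Fourier basis. -/

namespace SteadyFlow

variable (F : SteadyFlow)

/-- The bounded operator `(L - c) Λ⁻¹`. -/
def symbolOp (c : ℝ) : L2 →L[ℂ] L2 :=
  -(∑ j, mulOpL (F.q j) (F.smooth_q j).continuous ∘L rieszL j)
  - (mulOpL (pderiv 0 F.θ) (F.smooth_θ.continuous_pderiv 0) ∘L rieszL 1
      - mulOpL (pderiv 1 F.θ) (F.smooth_θ.continuous_pderiv 1) ∘L rieszL 0) ∘L LamInvL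
  - ContinuousLinearMap.id ℂ L2 - (c : ℂ) • LamInvL

lemma symbolOp_apply (c : ℝ) (v : L2) :
    F.symbolOp c v =
      -(∑ j, mulOp (F.q j) (F.smooth_q j).continuous (riesz j v))
      - (mulOp (pderiv 0 F.θ) (F.smooth_θ.continuous_pderiv 0) (riesz 1 (LamInv v))
          - mulOp (pderiv 1 F.θ) (F.smooth_θ.continuous_pderiv 1) (riesz 0 (LamInv v)))
      - v - (c : ℂ) • LamInv v := by
  simp only [symbolOp, Fin.sum_univ_two]
  rfl

lemma coef_q_zero (m : Freq) :
    coef (F.q 0) m = Complex.I * m 1 / freqNorm m * coef F.θ m := by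
  have h := congrArg (fun v => fourierBasis.repr v m) F.q_zero
  have hpi : ((2 * Real.pi : ℝ) : ℂ)⁻¹ ≠ 0 := inv_ne_zero (by exact_mod_cast Real.two_pi_pos.ne')
  simp only [repr_riesz] at h
  rw [repr_eq_inner, repr_eq_inner, inner_toL2, inner_toL2, mul_left_comm] at h
  exact mul_left_cancel₀ hpi h

lemma coef_q_one (m : Freq) :
    coef (F.q 1) m = -(Complex.I * m 0 / freqNorm m * coef F.θ m) := by
  have h := congrArg (fun v => fourierBasis.repr v m) F.q_one
  have hpi : ((2 * Real.pi : ℝ) : ℂ)⁻¹ ≠ 0 := inv_ne_zero (by exact_mod_cast Real.two_pi_pos.ne')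
  simp only [map_neg, lp.coeFn_neg, Pi.neg_apply, repr_riesz] at h
  rw [repr_eq_inner, repr_eq_inner, inner_toL2, inner_toL2, mul_left_comm, ← mul_neg] at h
  exact mul_left_cancel₀ hpi h

/-- The velocity is divergence free. -/
lemma coef_div (m : Freq) : coef (F.q 0) m * m 0 + coef (F.q 1) m * m 1 = 0 := by
  rw [coef_q_zero, coef_q_one]
  ring

/-- The matrix of the transport term `-q·∇`. -/
def transportMatrix (k l : Freq) : ℂ :=
  -(((2 * Real.pi : ℝ) : ℂ)⁻¹ ^ 2 * (Complex.I *
    (coef (F.q 0) (k - l) * l 0 + coef (F.q 1) (k - l) * l 1)))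

/-- The matrix of the order zero term `v ↦ -(R₂ v, -R₁ v)·∇θ`. -/
def rieszMatrix (k l : Freq) : ℂ :=
  -(((2 * Real.pi : ℝ) : ℂ)⁻¹ ^ 2 * (coef (pderiv 0 F.θ) (k - l) * (Complex.I * l 1 / freqNorm l) -
    coef (pderiv 1 F.θ) (k - l) * (Complex.I * l 0 / freqNorm l)))

/-- A convolution kernel dominating the coefficients of the linearized operator. -/
def kernel (m : Freq) : ℝ :=
  (2 * Real.pi)⁻¹ ^ 2 * (‖coef (F.q 0) m‖ + ‖coef (F.q 1) m‖ + ‖coef (pderiv 0 F.θ) m‖ +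
    ‖coef (pderiv 1 F.θ) m‖)

lemma kernel_nonneg (m : Freq) : 0 ≤ F.kernel m := by
  unfold kernel
  positivity

lemma summable_kernel : Summable fun m => F.kernel m * (1 + freqNorm m) ^ 5 := by
  have h := ((((summable_coef_mul_pow (F.smooth_q 0) 5).add
    (summable_coef_mul_pow (F.smooth_q 1) 5)).add
    (summable_coef_mul_pow (F.smooth_θ.pderiv 0) 5)).add
    (summable_coef_mul_pow (F.smooth_θ.pderiv 1) 5)).mul_left ((2 * Real.pi)⁻¹ ^ 2)
  refine h.congr fun m => ?_
  rw [kernel]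
  ring

lemma norm_scale : ‖((2 * Real.pi : ℝ) : ℂ)⁻¹ ^ 2‖ = (2 * Real.pi)⁻¹ ^ 2 := by
  rw [norm_pow, norm_inv, Complex.norm_real, Real.norm_of_nonneg Real.two_pi_pos.le]

lemma norm_transportMatrix_le (k l : Freq) :
    ‖F.transportMatrix k l‖ ≤ F.kernel (k - l) * freqNorm l := by
  rw [transportMatrix, norm_neg, norm_mul, norm_scale, norm_mul, Complex.norm_I, one_mul, kernel,
    mul_assoc]
  refine mul_le_mul_of_nonneg_left ((norm_add_le _ _).trans ?_) (by positivity)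
  rw [norm_mul, norm_mul, Complex.norm_intCast, Complex.norm_intCast]
  have h0 := mul_le_mul_of_nonneg_left (abs_le_freqNorm l 0) (norm_nonneg (coef (F.q 0) (k - l)))
  have h1 := mul_le_mul_of_nonneg_left (abs_le_freqNorm l 1) (norm_nonneg (coef (F.q 1) (k - l)))
  have h2 := mul_nonneg (norm_nonneg (coef (pderiv 0 F.θ) (k - l))) (freqNorm_nonneg l)
  have h3 := mul_nonneg (norm_nonneg (coef (pderiv 1 F.θ) (k - l))) (freqNorm_nonneg l)
  linarith

lemma norm_rieszMatrix_le (k l : Freq) : ‖F.rieszMatrix k l‖ ≤ F.kernel (k - l) := by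
  have h : ∀ j, ‖(Complex.I * l j / freqNorm l : ℂ)‖ ≤ 1 := fun j => by
    rw [norm_div, norm_mul, Complex.norm_I, one_mul, Complex.norm_intCast, Complex.norm_real]
    exact div_le_one_of_le₀ ((abs_le_freqNorm l j).trans (le_abs_self _)) (norm_nonneg _)
  rw [rieszMatrix, norm_neg, norm_mul, norm_scale, kernel]
  refine mul_le_mul_of_nonneg_left ((norm_sub_le _ _).trans ?_) (by positivity)
  rw [norm_mul, norm_mul]
  have h0 := mul_le_mul_of_nonneg_left (h 1) (norm_nonneg (coef (pderiv 0 F.θ) (k - l)))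
  have h1 := mul_le_mul_of_nonneg_left (h 0) (norm_nonneg (coef (pderiv 1 F.θ) (k - l)))
  linarith [norm_nonneg (coef (F.q 0) (k - l)), norm_nonneg (coef (F.q 1) (k - l))]

/-- `q` is real, so conjugation flips the sign of `k - l`; trading the factor `k` for `l` is free
because `(k - l) · q̂(k - l) = 0`. -/
lemma transportMatrix_skew (k l : Freq) :
    conj (F.transportMatrix l k) = -F.transportMatrix k l := by
  have h : l - k = -(k - l) := (neg_sub k l).symm
  have hdiv := F.coef_div (k - l)
  rw [transportMatrix, transportMatrix, h, coef_neg, coef_neg]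
  simp only [map_neg, map_mul, map_add, map_pow, map_inv₀, Complex.conj_ofReal, Complex.conj_I,
    Complex.conj_conj, map_intCast]
  simp only [Pi.sub_apply, Int.cast_sub] at hdiv
  linear_combination ((2 * Real.pi : ℝ) : ℂ)⁻¹ ^ 2 * Complex.I * hdiv

lemma inner_symbolOp_expL2 (c : ℝ) (k l : Freq) :
    inner ℂ (expL2 k) (F.symbolOp c (expL2 l)) =
      (freqNorm l : ℂ)⁻¹ * (F.transportMatrix k l + F.rieszMatrix k l) -
        (1 + c * (freqNorm l : ℂ)⁻¹) * (if k = l then 1 else 0) := by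
  have h : inner ℂ (expL2 k) (expL2 l) = if k = l then (1 : ℂ) else 0 :=
    orthonormal_iff_ite.1 orthonormal_expL2 k l
  rw [symbolOp_apply, Fin.sum_univ_two]
  simp only [riesz_expL2, LamInv_expL2, map_smul, inner_sub_right, inner_neg_right, inner_add_right,
    inner_smul_right, inner_mulOp, h]
  rw [transportMatrix, rieszMatrix]
  ring

/-- Both terms are multiples of `l 0 * l 1` with opposite signs. With `transportMatrix_zero` this
shows that the operator preserves mean-free functions. -/
lemma rieszMatrix_zero (l : Freq) : F.rieszMatrix 0 l = 0 := by
  rw [rieszMatrix, coef_pderiv F.smooth_θ, coef_pderiv F.smooth_θ]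
  simp only [Pi.sub_apply, Pi.zero_apply, zero_sub, Int.cast_neg]
  ring

lemma transportMatrix_zero (l : Freq) : F.transportMatrix 0 l = 0 := by
  have h := F.coef_div (0 - l)
  simp only [Pi.sub_apply, Pi.zero_apply, zero_sub, Int.cast_neg] at h
  rw [transportMatrix, zero_sub]
  linear_combination ((2 * Real.pi : ℝ) : ℂ)⁻¹ ^ 2 * Complex.I * h

lemma symbolOp_mem_L2mf (c : ℝ) (v : L2mf) : F.symbolOp c v ∈ L2mf := by
  have h : ((innerSL ℂ (expL2 0)) ∘L F.symbolOp c ∘L L2mf.subtypeL) = 0 := by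
    refine ContinuousLinearMap.ext_on
      (Submodule.dense_iff_topologicalClosure_eq_top.2 mfBasis.dense_span) ?_
    rintro _ ⟨k, rfl⟩
    change inner ℂ (expL2 0) (F.symbolOp c (mfBasis k : L2mf)) = 0
    rw [mfBasis_coe, inner_symbolOp_expL2, rieszMatrix_zero, transportMatrix_zero,
      if_neg k.2.symm]
    ring
  exact mem_L2mf_iff.2 (DFunLike.congr_fun h v)

/-- The operator `(L - c) Λ⁻¹` on mean-free functions. -/
def symbolOpMf (c : ℝ) : L2mf →L[ℂ] L2mf :=
  (F.symbolOp c ∘L L2mf.subtypeL).codRestrict L2mf fun v => F.symbolOp_mem_L2mf c v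

/-- The total weighted mass of the kernel. -/
def kernelMass : ℝ := ∑' m, F.kernel m * (1 + freqNorm m) ^ 5

lemma sum_kernel_le (A : Finset NzFreq) {g : NzFreq → Freq} (hg : Function.Injective g) :
    ∑ l ∈ A, F.kernel (g l) * (1 + freqNorm (g l)) ^ 5 ≤ F.kernelMass := by
  have h := F.summable_kernel.sum_le_tsum (A.map ⟨g, hg⟩) fun m _ =>
    mul_nonneg (F.kernel_nonneg m) (pow_nonneg (by linarith [freqNorm_nonneg m]) _)
  rwa [Finset.sum_map] at h

lemma kernelMass_nonneg : 0 ≤ F.kernelMass :=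
  tsum_nonneg fun m => mul_nonneg (F.kernel_nonneg m)
    (pow_nonneg (by linarith [freqNorm_nonneg m]) _)

/-- The weights undo `Λ⁻¹`, leaving the truncated matrix of `L - c` in the form treated by
`matrix_energy_le`. -/
lemma inner_symbolOpMf_sum (c : ℝ) (A : Finset NzFreq) {k : NzFreq} (hk : k ∈ A) (u : NzFreq → ℂ) :
    inner ℂ (mfBasis k) (F.symbolOpMf c (∑ l ∈ A, ((freqNorm l : ℂ) * u l) • mfBasis l)) =
      ∑ l ∈ A, (F.transportMatrix k l + F.rieszMatrix k l) * u l -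
        ((freqNorm k + c : ℝ) : ℂ) * u k := by
  have h1 : ∀ l : NzFreq, inner ℂ (mfBasis k) (F.symbolOpMf c (mfBasis l)) =
      (freqNorm l : ℂ)⁻¹ * (F.transportMatrix k l + F.rieszMatrix k l) -
        (1 + c * (freqNorm l : ℂ)⁻¹) * (if k = l then 1 else 0) := by
    intro l
    rw [Submodule.coe_inner, mfBasis_coe]
    change inner ℂ (expL2 k) (F.symbolOp c (mfBasis l : L2mf)) = _
    rw [mfBasis_coe, inner_symbolOp_expL2]
    simp only [Subtype.ext_iff]
  have hne : ∀ l : NzFreq, (freqNorm l : ℂ) ≠ 0 := fun l => by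
    exact_mod_cast (zero_lt_one.trans_le (one_le_freqNorm l.2)).ne'
  have h2 : ∀ l ∈ A,
      inner ℂ (mfBasis k) (((freqNorm l : ℂ) * u l) • F.symbolOpMf c (mfBasis l)) =
      (F.transportMatrix k l + F.rieszMatrix k l) * u l -
        if k = l then ((freqNorm k + c : ℝ) : ℂ) * u k else 0 := by
    intro l _
    refine (inner_smul_right (𝕜 := ℂ) (mfBasis k) (F.symbolOpMf c (mfBasis l)) _).trans ?_
    rw [h1]
    have := hne l
    split_ifs with h
    · subst h
      push_cast
      field_simp
    · field_simp
      ring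
  simp only [map_sum, map_smul, inner_sum]
  rw [Finset.sum_congr rfl h2, Finset.sum_sub_distrib, Finset.sum_ite_eq, if_pos hk]

/-- The operator `L - c`, as a dissipative system. -/
def system (c : ℝ) : DissipativeSystem NzFreq L2mf where
  b := mfBasis
  w k := freqNorm k
  G := LamInvMf
  M := F.symbolOpMf c
  K := 2 * F.kernelMass + |c|
  one_le_w k := one_le_freqNorm k.2
  finite_w := finite_freqNorm_le
  inner_G k v := by
    rw [inner_mfBasis, inner_mfBasis]
    exact repr_LamInv v k
  K_nonneg := add_nonneg (mul_nonneg zero_le_two F.kernelMass_nonneg) (abs_nonneg c)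
  energy n h1 h2 A u := by
    have h := matrix_energy_le (w := fun k : NzFreq => freqNorm k)
      (κ := fun k l => F.kernel (k - l)) (d := fun k l => freqNorm (k - l)) (S := F.kernelMass)
      (fun k => one_le_freqNorm k.2) (fun k l => abs_freqNorm_sub_le k l)
      (fun k l => F.kernel_nonneg _) h1 h2 A
      -- The kernel depends on `k - l` only, so every row and column sum is part of the total mass.
      (fun k => F.sum_kernel_le A (g := fun l => k - l) fun l l' h =>
        Subtype.ext (sub_right_injective h))
      (fun l => F.sum_kernel_le A (g := fun k => k - l) fun k k' h =>
        Subtype.ext (sub_left_injective h))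
      (fun k l => F.norm_transportMatrix_le k l) (fun k l => F.transportMatrix_skew k l)
      (fun k l => F.norm_rieszMatrix_le k l) c fun k => inner ℂ (mfBasis k) u
    refine le_trans (le_of_eq (Finset.sum_congr rfl fun k hk => ?_)) h
    rw [F.inner_symbolOpMf_sum c A hk fun l => inner ℂ (mfBasis l) u]

/-! ### Identification of the abstract generator with `L - c`. -/

lemma LamInv_mem_H1mf (x : L2mf) : LamInv (x : L2) ∈ H1mf := by
  refine ⟨?_, LamInv_mem_L2mf x.2⟩
  change LamInv (x : L2) ∈ (fourierMultiplier _).domain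
  rw [mem_fourierMultiplier_domain]
  refine (lp.memℓp (fourierBasis.repr (x : L2))).mono' fun k => ?_
  rw [repr_LamInv, ← mul_assoc, norm_mul, norm_mul, norm_inv]
  exact mul_le_of_le_one_left (norm_nonneg _) mul_inv_le_one

lemma Lam_LamInv (x : L2mf) : Lam ⟨LamInv (x : L2), H1mf_le_Lam (LamInv_mem_H1mf x)⟩ = x := by
  refine ext_repr fun k => ?_
  refine (repr_fourierMultiplier _ _ k).trans ?_
  change (freqNorm k : ℂ) * fourierBasis.repr (LamInv (x : L2)) k = _
  rw [repr_LamInv]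
  by_cases hk : k = 0
  · have h := mem_L2mf_iff.1 x.2
    rw [← repr_eq_inner] at h
    rw [hk, h, mul_zero, mul_zero]
  · have hne : (freqNorm k : ℂ) ≠ 0 := by
      exact_mod_cast (zero_lt_one.trans_le (one_le_freqNorm hk)).ne'
    rw [mul_inv_cancel_left₀ hne]

lemma partialD_LamInv (j : Fin 2) (x : L2mf) :
    partialD j ⟨LamInv (x : L2), H1mf_le_partialD j (LamInv_mem_H1mf x)⟩ = riesz j x := by
  refine ext_repr fun k => ?_
  refine (repr_fourierMultiplier _ _ k).trans ?_
  change Complex.I * (k j : ℂ) * fourierBasis.repr (LamInv (x : L2)) k = _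
  rw [repr_LamInv, repr_riesz]
  ring

/-- The witness is `Λ v`, mean-free since the symbol vanishes at `0`. Thus the range of `G` is
exactly the domain of `L`. -/
lemma exists_LamInv_eq {v : L2} (hv : v ∈ H1mf) : ∃ x : L2mf, v = LamInv (x : L2) := by
  have hrepr : ∀ k, fourierBasis.repr (Lam ⟨v, H1mf_le_Lam hv⟩) k =
      (freqNorm k : ℂ) * fourierBasis.repr v k := fun k => repr_fourierMultiplier _ _ k
  have h0 : freqNorm 0 = 0 := by simp [freqNorm]
  refine ⟨⟨Lam ⟨v, H1mf_le_Lam hv⟩, ?_⟩, ext_repr fun k => ?_⟩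
  · rw [mem_L2mf_iff, ← repr_eq_inner, hrepr, h0, Complex.ofReal_zero, zero_mul]
  · rw [repr_LamInv, hrepr]
    by_cases hk : k = 0
    · have h := mem_L2mf_iff.1 hv.2
      rw [← repr_eq_inner] at h
      rw [hk, h, mul_zero, mul_zero]
    · have hne : (freqNorm k : ℂ) ≠ 0 := by
        exact_mod_cast (zero_lt_one.trans_le (one_le_freqNorm hk)).ne'
      rw [inv_mul_cancel_left₀ hne]

lemma shift_L_apply_LamInv (c : ℝ) (x : L2mf) (h : LamInv (x : L2) ∈ (shift F.L c).domain) :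
    shift F.L c ⟨LamInv (x : L2), h⟩ = F.symbolOp c x := by
  have e : shift F.L c ⟨LamInv (x : L2), h⟩ =
      F.Lfun ⟨LamInv (x : L2), h⟩ - (c : ℂ) • LamInv (x : L2) := rfl
  rw [e, Lfun_apply, symbolOp_apply, Lam_LamInv]
  simp only [partialD_LamInv]

/-- This carries the spectral hypothesis on `L` over to the system; the eigenvector of `L` is `Λ⁻¹
x`. -/
lemma isEigenvalue_of_system {c : ℝ} {ν : ℂ} {x : L2mf} (hx : x ≠ 0)
    (h : (F.system c).M x = ν • (F.system c).G x) : IsEigenvalue F.L (ν + c) := by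
  have h1 : F.symbolOp c x = ν • LamInv (x : L2) := congrArg Subtype.val h
  refine ⟨⟨LamInv (x : L2), LamInv_mem_H1mf x⟩, fun h0 => hx ?_, ?_⟩
  · exact (F.system c).G_injective (Subtype.ext (by
      rw [map_zero]
      exact h0))
  · have h2 : F.L ⟨LamInv (x : L2), LamInv_mem_H1mf x⟩ - (c : ℂ) • LamInv (x : L2) =
        F.symbolOp c x := F.shift_L_apply_LamInv c x (LamInv_mem_H1mf x)
    rw [add_smul, ← h1, ← h2, sub_add_cancel]

/-- The semigroup generated by `L - c`. -/
def semigroup (c : ℝ) : C0Semigroup L2mf where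
  T := (F.system c).T
  map_zero := (F.system c).T_zero
  map_add _ _ hs ht := (F.system c).T_add hs ht
  tendsto_zero := (F.system c).tendsto_T_zero

lemma semigroup_isGeneratedBy (c : ℝ) :
    (F.semigroup c).IsGeneratedBy (shift F.L (c : ℂ)) := by
  refine ⟨fun v hv => hv.2, fun v => ?_, fun v w => ?_⟩
  · obtain ⟨v, hv⟩ := v
    obtain ⟨x, rfl⟩ := exists_LamInv_eq hv
    rw [shift_L_apply_LamInv]
    exact F.symbolOp_mem_L2mf c x
  · refine ((F.system c).tendsto_iff_exists_G v w).trans ⟨?_, ?_⟩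
    · rintro ⟨x, rfl, rfl⟩
      exact ⟨LamInv_mem_H1mf x, F.shift_L_apply_LamInv c x _⟩
    · rintro ⟨h, hw⟩
      obtain ⟨x, hx⟩ := exists_LamInv_eq h
      refine ⟨x, Subtype.ext hx, Subtype.ext ?_⟩
      rw [← hw]
      obtain ⟨v, hv⟩ := v
      subst hx
      exact (F.shift_L_apply_LamInv c x h).symm

end SteadyFlow

end QG

end

/-! ### The theorem. -/

theorem lemma3p2 (F : QG.SteadyFlow) (μ : ℂ) (hμ : QG.IsEigenvalue F.L μ) (hpos : 0 < μ.re)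
    (hmax : ∀ ν : ℂ, QG.IsEigenvalue F.L ν → ν.re ≤ μ.re) (δ : ℝ) (hδ : 0 < δ) :
    ∃ S : QG.C0Semigroup QG.L2mf,
      S.IsGeneratedBy (QG.shift F.L ((μ.re + δ : ℝ) : ℂ)) ∧
      ∀ γ : ℝ, 0 ≤ γ → γ ≤ 1 → ∃ C : ℝ, 0 < C ∧
        ∀ v : QG.L2mf, QG.HasSmoothRep (v : QG.L2) → ∀ t : ℝ, 0 < t →
          ‖S.T t v‖ ≤ C / t ^ γ * ‖v‖ ^ (1 - γ) * ‖QG.LamInv (v : QG.L2)‖ ^ γ := by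
  refine ⟨F.semigroup (μ.re + δ), F.semigroup_isGeneratedBy (μ.re + δ), fun γ hγ₀ hγ₁ => ?_⟩
  -- An eigenvalue `ν` of the shifted operator makes `ν + μ.re + δ` an eigenvalue of `L`, so `ν.re ≤
  -- -δ`.
  obtain ⟨C, hC, h⟩ := (F.system (μ.re + δ)).exists_norm_T_le_rpow hδ (fun ν x hx hM => by
    have h1 := hmax _ (F.isEigenvalue_of_system hx hM)
    rw [Complex.add_re, Complex.ofReal_re] at h1
    linarith) hγ₀ hγ₁
  exact ⟨C, hC, fun v _ t ht => h v t ht⟩
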